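/- Let $A\in\mathbb{R}^{m\times n}$ be non-degenerate (full column rank and no zero row), let $b\in\mathbb{R}^m$, and suppose that the open polyhedron $\Omega^\circ=\{x\in\mathbb{R}^n : Ax>b\}$ is non-empty. For $x\in\Omega^\circ$ put $A_x=\mathrm{Diag}(Ax-b)^{-1}A$. Fix $q>0$ and, with $W=\mathrm{Diag}(w)$, define \[ f(x,w)=\log\det\bigl(A_x^\top W^{1-\frac2q}A_x\bigr)-\Bigl(1-\frac2q\Bigr)\sum_{i=1}^m w_i , \qquad \psi(x)=\begin{cases}\max_{w\in\mathbb{R}^m,\,w\ge 0}\tfrac12 f(x,w) & \text{if } q\ge 2,\\[2pt] \min_{w\in\mathbb{R}^m,\,w\ge 0}\tfrac12 f(x,w) & \text{if } q\le 2,\end{cases} \] where $f(x,w)=-\infty$ if $q>2$ and $A_x^\top W^{1-2/q}A_x$ is singular, $f(x,w)=+\infty$ if $q<2$ and some $w_i=0$, and $W^0=I$ if $q=2$ (then $f$ does not depend on $w$). Then for every $x\in\Omega^\circ$ the maximum, respectively minimum, is attained at a finite value, and $\psi:\Omega^\circ\to\mathbb{R}$ is a barrier function for $\Omega^\circ$: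 it is convex and three times continuously differentiable, and $\psi(x_k)\to+\infty$ for every sequence $x_k\in\Omega^\circ$ that converges to a point of the boundary of $\Omega^\circ$. For all $x\in\Omega^\circ$ and $h\in\mathbb{R}^n$ the Hessian $\nabla^2\psi(x)$ is positive definite and, with $\|h\|_{\nabla^2\psi(x)}=(h^\top\nabla^2\psi(x)h)^{1/2}$, 1. $\nabla\psi(x)^\top\,\nabla^2\psi(x)^{-1}\,\nabla\psi(x)\le n$; 2. $|D^3\psi(x)[h,h,h]|\le 2v_q\,\|h\|_{\nabla^2\psi(x)}^{3}$, where $v_q=(q+2)^{3/2}m^{\frac1{q+2}}+4\max\{q,2\}^{5/2}$. Consequently $\phi=v_q^2\psi$ is a $\nu$-self-concordant barrier for $\Omega^\circ$ with $\nu=n v_q^2$; that is, $\phi$ is a barrier function for $\Omega^\circ$ in the above sense and, for all $x\in\Omega^\circ$ and $h\in\mathbb{R}^n$, $|D^3\phi(x)[h,h,h]|\le 2|D^2\phi(x)[h,h]|^{3/2}$ and $|D\phi(x)[h]|\le\sqrt{\nu}\,|D^2\phi(x)[h,h]|^{1/2}$. -/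

import Mathlib

open Filter Topology
open scoped Matrix

noncomputable section

namespace LewisBarrier

/-- Full column rank and no zero rows. -/
def NonDegenerate {m n : ℕ} (A : Matrix (Fin m) (Fin n) ℝ) : Prop :=
  A.rank = n ∧ ∀ i, A i ≠ 0

/-- The open polyhedron `{x | A x > b}`. -/
def interiorSet {m n : ℕ} (A : Matrix (Fin m) (Fin n) ℝ) (b : Fin m → ℝ) :
    Set (Fin n → ℝ) :=
  {x | ∀ i, b i < (A *ᵥ x) i}

/-- `A_x = S_x⁻¹ A` with `S_x = Diag (A x - b)`. -/
def scaledMatrix {m n : ℕ} (A : Matrix (Fin m) (Fin n) ℝ) (b : Fin m → ℝ)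
    (x : Fin n → ℝ) : Matrix (Fin m) (Fin n) ℝ :=
  Matrix.diagonal (fun i => ((A *ᵥ x) i - b i)⁻¹) * A

/-- `Mᵀ W^(1 - 2/q) M` with `W = Diag w`. -/
def weightedGram {m n : ℕ} (q : ℝ) (M : Matrix (Fin m) (Fin n) ℝ) (w : Fin m → ℝ) :
    Matrix (Fin n) (Fin n) ℝ :=
  Mᵀ * Matrix.diagonal (fun i => w i ^ (1 - 2 / q)) * M

/-- `f(x, w) = log det (A_xᵀ W^(1 - 2/q) A_x) - (1 - 2/q) ∑ i, w i`. -/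
def potential {m n : ℕ} (q : ℝ) (A : Matrix (Fin m) (Fin n) ℝ) (b : Fin m → ℝ)
    (x : Fin n → ℝ) (w : Fin m → ℝ) : ℝ :=
  Real.log (weightedGram q (scaledMatrix A b x) w).det - (1 - 2 / q) * ∑ i, w i

/-- The weights `w ≥ 0` at which `f(x, w)` is a finite real number.
For `q > 2` a weight with singular Gram matrix has `f = -∞`, and for `q < 2` a weight with a zero
entry has `f = +∞` because of the negative exponent `1 - 2/q`; neither can be an optimizer, and
both are left out so that the values of `Real.log` and `Real.rpow` at `0` do not enter. -/
def admissibleWeights {m n : ℕ} (q : ℝ) (A : Matrix (Fin m) (Fin n) ℝ) (b : Fin m → ℝ)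
    (x : Fin n → ℝ) : Set (Fin m → ℝ) :=
  {w | (∀ i, 0 ≤ w i) ∧ (q < 2 → ∀ i, 0 < w i) ∧
    0 < (weightedGram q (scaledMatrix A b x) w).det}

/-- The set of values `f(x, w) / 2` over the weights `w ≥ 0`. -/
def barrierValues {m n : ℕ} (q : ℝ) (A : Matrix (Fin m) (Fin n) ℝ) (b : Fin m → ℝ)
    (x : Fin n → ℝ) : Set ℝ :=
  (fun w => (1 / 2 : ℝ) * potential q A b x w) '' admissibleWeights q A b x

open Classical in
/-- The Lewis weight barrier `ψ`: the largest value of `f(x, ·) / 2` if `q ≥ 2`,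
the smallest one if `q ≤ 2` (for `q = 2` there is only one value). -/
def barrier {m n : ℕ} (q : ℝ) (A : Matrix (Fin m) (Fin n) ℝ) (b : Fin m → ℝ)
    (x : Fin n → ℝ) : ℝ :=
  if 2 ≤ q then sSup (barrierValues q A b x) else sInf (barrierValues q A b x)

/-- The gradient as the vector of partial derivatives. -/
def grad {n : ℕ} (φ : (Fin n → ℝ) → ℝ) (x : Fin n → ℝ) : Fin n → ℝ :=
  fun i => fderiv ℝ φ x (Pi.single i 1)

/-- The Hessian as the matrix of second partial derivatives. -/
def hess {n : ℕ} (φ : (Fin n → ℝ) → ℝ) (x : Fin n → ℝ) : Matrix (Fin n) (Fin n) ℝ :=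
  Matrix.of fun i j => iteratedFDeriv ℝ 2 φ x ![Pi.single i 1, Pi.single j 1]

/-- `φ` tends to `+∞` along every sequence in `K` that converges to a boundary point of `K`. -/
def BlowsUpAtBoundary {n : ℕ} (K : Set (Fin n → ℝ)) (φ : (Fin n → ℝ) → ℝ) : Prop :=
  ∀ u : ℕ → (Fin n → ℝ), (∀ k, u k ∈ K) →
    ∀ p ∈ frontier K, Tendsto u atTop (𝓝 p) → Tendsto (fun k => φ (u k)) atTop atTop

/-- Barrier functions for an open convex set: convex, thrice continuously differentiable, and
tending to `+∞` at the boundary. -/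
structure IsBarrier {n : ℕ} (K : Set (Fin n → ℝ)) (φ : (Fin n → ℝ) → ℝ) : Prop where
  isOpen : IsOpen K
  convexOn : ConvexOn ℝ K φ
  contDiffOn : ContDiffOn ℝ 3 φ K
  blowsUp : BlowsUpAtBoundary K φ

/-- `ν`-self-concordant barrier functions for the open convex set `K`. -/
structure IsSelfConcordantBarrier {n : ℕ} (ν : ℝ) (K : Set (Fin n → ℝ))
    (φ : (Fin n → ℝ) → ℝ) : Prop extends IsBarrier K φ where
  third_le : ∀ x ∈ K, ∀ h : Fin n → ℝ,
    |iteratedFDeriv ℝ 3 φ x ![h, h, h]| ≤ 2 * |iteratedFDeriv ℝ 2 φ x ![h, h]| ^ (3 / 2 : ℝ)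
  first_le : ∀ x ∈ K, ∀ h : Fin n → ℝ,
    |fderiv ℝ φ x h| ≤ √ν * |iteratedFDeriv ℝ 2 φ x ![h, h]| ^ (1 / 2 : ℝ)

/-- `v_q = (q + 2)^(3/2) m^(1/(q + 2)) + 4 max{q, 2}^(5/2)`. -/
def concordanceConst (q : ℝ) (m : ℕ) : ℝ :=
  (q + 2) ^ (3 / 2 : ℝ) * (m : ℝ) ^ (1 / (q + 2)) + 4 * (max q 2) ^ (5 / 2 : ℝ)

end LewisBarrier

end

noncomputable section

namespace LewisBarrier

/-! ### Gram matrices, leverage scores and the projection in log-weight coordinates -/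

section

variable {m n : ℕ} {A : Matrix (Fin m) (Fin n) ℝ}

/-! Put the row weights on a logarithmic scale: for ℓ ∈ ℝ^m and D = diag(e^ℓ), the matrix P =
D^{1/2} A (AᵀDA)⁻¹ Aᵀ D^{1/2} is an orthogonal projection of rank n. Its diagonal is `lev`; its
entrywise square is R = `projSq`. With s = Ax - b, a positive stationary point w of f(x, ·) for q ≠
2 is w = `lev A ℓ` with e^ℓ = w^{1-2/q} s⁻², that is, `lewisMap A q ℓ` = ℓ - (1-2/q) log `lev A ℓ` =
-2 log s. This map is smooth, proper and has invertible derivative everywhere, so its range is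
clopen and it is onto; its local inverses give C³ solutions ℓ(x).

Such a solution is a global optimizer. For q ≥ 2 this uses concavity of log det in the weights e^ℓ
together with the weighted AM-GM inequality; for q ≤ 2 it uses convexity of log det in ℓ together
with log t ≤ t - 1. As ∑ w = n, the barrier equals ½ (`logDet A ℓ` - (1-2/q) n).

Along a line, let y, z, ρ be the derivatives of log s, ℓ, log w, and W = diag(w). Then z = (1-2/q)ρ
- 2y and Wρ = (W - R)z. Since 0 ≤ R ≤ W as quadratic forms, ∑wρ² ≤ ∑wzρ ≤ ∑wz²
(`LewisVelocity.sum_sq_le`, `LewisVelocity.le_sum`), and these inequalities drive all estimates on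
the second derivative. One finds ψ' = -∑wy and ψ'' = ∑w(y² - ρy) ≥ ∑wy²; with ∑w = n, Cauchy-Schwarz
bounds the gradient.

The third derivative is a sum of cubic terms in y, ρ, z - ρ plus a trace term `projCube`. Each is
bounded by the sup norm of one factor times two weighted ℓ² norms. The sup norm of z - ρ is at most
the weighted norm of z; that of y costs m^{1/(q+2)}, because the Lewis equation gives y_i² ≤
w_i^{2/q} ∑ w^{1-2/q} y² and Hölder's inequality converts the right side (`sq_le_rpow_mul_sum`).

Finally, supporting planes of log det at ℓ = 0 give ψ ≥ const - ∑ lev(0) log s, which blows up at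
the boundary (`barrier_ge`). -/

theorem NonDegenerate.injective (hA : NonDegenerate A) : Function.Injective A.mulVec := by
  have h := LinearMap.finrank_range_add_finrank_ker A.mulVecLin
  have h1 : Module.finrank ℝ A.mulVecLin.range = n := hA.1
  rw [h1, Module.finrank_fin_fun] at h
  have h2 : A.mulVecLin.ker = ⊥ := Submodule.finrank_eq_zero.mp (by omega)
  exact LinearMap.ker_eq_bot.mp h2

/-- `Aᵀ diag(e^ℓ) A`. -/
def expGram (A : Matrix (Fin m) (Fin n) ℝ) (l : Fin m → ℝ) : Matrix (Fin n) (Fin n) ℝ :=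
  Aᵀ * Matrix.diagonal (fun i => Real.exp (l i)) * A

/-- `A (Aᵀ diag(e^ℓ) A)⁻¹ Aᵀ`. -/
def hat (A : Matrix (Fin m) (Fin n) ℝ) (l : Fin m → ℝ) : Matrix (Fin m) (Fin m) ℝ :=
  A * (expGram A l)⁻¹ * Aᵀ

/-- The leverage scores of `diag(e^(ℓ/2)) A`. -/
def lev (A : Matrix (Fin m) (Fin n) ℝ) (l : Fin m → ℝ) (i : Fin m) : ℝ :=
  Real.exp (l i) * hat A l i i

/-- The squared entries of the orthogonal projection onto the range of `diag(e^(ℓ/2)) A`. -/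
def projSq (A : Matrix (Fin m) (Fin n) ℝ) (l : Fin m → ℝ) (i j : Fin m) : ℝ :=
  Real.exp (l i) * Real.exp (l j) * hat A l i j ^ 2

/-- `log det (Aᵀ diag(e^ℓ) A)`. -/
def logDet (A : Matrix (Fin m) (Fin n) ℝ) (l : Fin m → ℝ) : ℝ :=
  Real.log (expGram A l).det

theorem expGram_posDef (hA : Function.Injective A.mulVec) (l : Fin m → ℝ) :
    (expGram A l).PosDef := by
  have := (Matrix.PosDef.diagonal (d := fun i => Real.exp (l i))
    (fun i => Real.exp_pos _)).conjTranspose_mul_mul_same hA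
  rwa [Matrix.conjTranspose_eq_transpose_of_trivial] at this

theorem isUnit_det_expGram (hA : Function.Injective A.mulVec) (l : Fin m → ℝ) :
    IsUnit (expGram A l).det :=
  (expGram_posDef hA l).det_pos.ne'.isUnit

theorem hat_transpose (hA : Function.Injective A.mulVec) (l : Fin m → ℝ) :
    (hat A l)ᵀ = hat A l := by
  have h : (expGram A l)⁻¹ᵀ = (expGram A l)⁻¹ := by
    have := (expGram_posDef hA l).inv.isHermitian.eq
    rwa [Matrix.conjTranspose_eq_transpose_of_trivial] at this
  simp [hat, Matrix.transpose_mul, h, Matrix.mul_assoc]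

theorem hat_comm (hA : Function.Injective A.mulVec) (l : Fin m → ℝ) (i j : Fin m) :
    hat A l i j = hat A l j i := by
  conv_lhs => rw [← hat_transpose hA l]
  rfl

theorem hat_mul_diagonal_mul (hA : Function.Injective A.mulVec) (l : Fin m → ℝ) :
    hat A l * Matrix.diagonal (fun i => Real.exp (l i)) * A = A := by
  calc hat A l * Matrix.diagonal (fun i => Real.exp (l i)) * A
      = A * ((expGram A l)⁻¹ * expGram A l) := by simp [hat, expGram, Matrix.mul_assoc]
    _ = A := by rw [Matrix.nonsing_inv_mul _ (isUnit_det_expGram hA l), Matrix.mul_one]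

/-- This is P² = P for P = D^{1/2} Q D^{1/2}, written without square roots. The identities below are
its entries. -/
theorem hat_mul_diagonal_mul_hat (hA : Function.Injective A.mulVec) (l : Fin m → ℝ) :
    hat A l * Matrix.diagonal (fun i => Real.exp (l i)) * hat A l = hat A l := by
  calc hat A l * Matrix.diagonal (fun i => Real.exp (l i)) * hat A l
      = hat A l * Matrix.diagonal (fun i => Real.exp (l i)) * A * ((expGram A l)⁻¹ * Aᵀ) := by
        rw [Matrix.mul_assoc _ A, ← Matrix.mul_assoc A, ← hat]
    _ = hat A l := by rw [hat_mul_diagonal_mul hA, ← Matrix.mul_assoc, ← hat]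

theorem sum_hat_mulVec (hA : Function.Injective A.mulVec) (l : Fin m → ℝ) (h : Fin n → ℝ)
    (i : Fin m) : ∑ j, hat A l i j * Real.exp (l j) * (A *ᵥ h) j = (A *ᵥ h) i := by
  conv_rhs => rw [← hat_mul_diagonal_mul hA l, ← Matrix.mulVec_mulVec]
  simp [Matrix.mulVec, dotProduct, Matrix.mul_diagonal]

theorem sum_hat_hat (hA : Function.Injective A.mulVec) (l : Fin m → ℝ) (i j : Fin m) :
    ∑ k, hat A l i k * Real.exp (l k) * hat A l k j = hat A l i j := by
  conv_rhs => rw [← hat_mul_diagonal_mul_hat hA l]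
  simp [Matrix.mul_apply, Matrix.diagonal_apply]

theorem sum_hat_sq (hA : Function.Injective A.mulVec) (l : Fin m → ℝ) (i : Fin m) :
    ∑ j, Real.exp (l j) * hat A l i j ^ 2 = hat A l i i := by
  rw [← sum_hat_hat hA l i i]
  refine Finset.sum_congr rfl fun j _ => ?_
  rw [hat_comm hA l j i]; ring

theorem hat_self_nonneg (hA : Function.Injective A.mulVec) (l : Fin m → ℝ) (i : Fin m) :
    0 ≤ hat A l i i := by
  rw [← sum_hat_sq hA]
  exact Finset.sum_nonneg fun j _ => mul_nonneg (Real.exp_pos _).le (sq_nonneg _)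

/-- Cauchy-Schwarz applied to the reproducing identity A h = Q D A h, where row i of Q has
D-weighted square norm Q_ii. -/
theorem mulVec_sq_le (hA : Function.Injective A.mulVec) (l : Fin m → ℝ) (h : Fin n → ℝ)
    (i : Fin m) :
    (A *ᵥ h) i ^ 2 ≤ hat A l i i * ∑ j, Real.exp (l j) * (A *ᵥ h) j ^ 2 := by
  rw [← sum_hat_sq hA]
  conv_lhs => rw [← sum_hat_mulVec hA l h i]
  apply Finset.sum_sq_le_sum_mul_sum_of_sq_le_mul
  · exact fun j _ => mul_nonneg (Real.exp_pos _).le (sq_nonneg _)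
  · exact fun j _ => mul_nonneg (Real.exp_pos _).le (sq_nonneg _)
  · intro j _
    apply le_of_eq; ring

theorem hat_self_pos (hA : NonDegenerate A) (l : Fin m → ℝ) (i : Fin m) : 0 < hat A l i i := by
  refine lt_of_le_of_ne (hat_self_nonneg hA.injective l i) fun h0 => hA.2 i ?_
  funext j
  have := mulVec_sq_le hA.injective l (Pi.single j 1) i
  rw [← h0, zero_mul] at this
  have h1 : (A *ᵥ Pi.single j 1) i = 0 := by
    exact pow_eq_zero_iff two_ne_zero |>.mp (le_antisymm this (sq_nonneg _))
  simpa using h1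

theorem hat_sq_le (hA : Function.Injective A.mulVec) (l : Fin m → ℝ) (i j : Fin m) :
    hat A l i j ^ 2 ≤ hat A l i i * hat A l j j := by
  rw [← sum_hat_sq hA l i, ← sum_hat_sq hA l j]
  conv_lhs => rw [← sum_hat_hat hA l i j]
  apply Finset.sum_sq_le_sum_mul_sum_of_sq_le_mul
  · exact fun j _ => mul_nonneg (Real.exp_pos _).le (sq_nonneg _)
  · exact fun j _ => mul_nonneg (Real.exp_pos _).le (sq_nonneg _)
  · intro k _
    apply le_of_eq; rw [hat_comm hA l k j]; ring

theorem lev_pos (hA : NonDegenerate A) (l : Fin m → ℝ) (i : Fin m) : 0 < lev A l i :=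
  mul_pos (Real.exp_pos _) (hat_self_pos hA l i)

theorem projSq_nonneg (l : Fin m → ℝ) (i j : Fin m) : 0 ≤ projSq A l i j := by
  unfold projSq; positivity

theorem projSq_comm (hA : Function.Injective A.mulVec) (l : Fin m → ℝ) (i j : Fin m) :
    projSq A l i j = projSq A l j i := by
  rw [projSq, projSq, hat_comm hA l i j]; ring

theorem sum_projSq (hA : Function.Injective A.mulVec) (l : Fin m → ℝ) (i : Fin m) :
    ∑ j, projSq A l i j = lev A l i := by
  rw [lev, ← sum_hat_sq hA, Finset.mul_sum]
  exact Finset.sum_congr rfl fun j _ => by rw [projSq]; ring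

theorem projSq_le (hA : Function.Injective A.mulVec) (l : Fin m → ℝ) (i j : Fin m) :
    projSq A l i j ≤ lev A l i * lev A l j := by
  have := mul_le_mul_of_nonneg_left (hat_sq_le hA l i j)
    (mul_pos (Real.exp_pos (l i)) (Real.exp_pos (l j))).le
  calc _ ≤ _ := this
    _ = _ := by rw [lev, lev]; ring

/-- A diagonal entry of a projection satisfies P_ii² ≤ ∑_j P_ij² = P_ii. -/
theorem lev_le_one (hA : NonDegenerate A) (l : Fin m → ℝ) (i : Fin m) : lev A l i ≤ 1 := by
  have h1 : projSq A l i i ≤ lev A l i := by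
    rw [← sum_projSq hA.injective]
    exact Finset.single_le_sum (fun j _ => projSq_nonneg l i j) (Finset.mem_univ i)
  have h2 : projSq A l i i = lev A l i ^ 2 := by rw [projSq, lev]; ring
  have := lev_pos hA l i
  nlinarith

/-- The trace of the projection is its rank. -/
theorem sum_lev (hA : Function.Injective A.mulVec) (l : Fin m → ℝ) : ∑ i, lev A l i = n := by
  have h1 : ∑ i, lev A l i =
      (Matrix.diagonal (fun i => Real.exp (l i)) * A * ((expGram A l)⁻¹ * Aᵀ)).trace := by
    rw [Matrix.mul_assoc, ← Matrix.mul_assoc A]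
    simp [Matrix.trace, Matrix.diagonal_mul, lev, hat]
  rw [h1, Matrix.trace_mul_comm, Matrix.mul_assoc, ← Matrix.mul_assoc Aᵀ]
  change ((expGram A l)⁻¹ * expGram A l).trace = n
  rw [Matrix.nonsing_inv_mul _ (isUnit_det_expGram hA l)]
  simp

/-- `∑ᵢⱼ Rᵢⱼ zᵢ zⱼ` is a sum of squares. -/
theorem sum_projSq_mul_mul (hA : Function.Injective A.mulVec) (l z : Fin m → ℝ) :
    ∑ i, ∑ j, projSq A l i j * z i * z j =
      ∑ i, ∑ j, Real.exp (l i) * Real.exp (l j) *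
        (∑ k, hat A l i k * (Real.exp (l k) * z k) * hat A l k j) ^ 2 := by
  set Q := hat A l
  set D := Matrix.diagonal fun i => Real.exp (l i)
  set Z := Matrix.diagonal fun i => Real.exp (l i) * z i
  have hQ : Q * D * Q = Q := hat_mul_diagonal_mul_hat hA l
  have hQt : ∀ i j, Q i j = Q j i := hat_comm hA l
  have h1 : ∑ i, ∑ j, projSq A l i j * z i * z j = (Z * Q * (Z * Q)).trace := by
    simp only [Matrix.trace, Matrix.diag, Matrix.mul_apply (N := Z * Q)]
    refine Finset.sum_congr rfl fun i _ => Finset.sum_congr rfl fun j _ => ?_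
    simp only [Z, Matrix.diagonal_mul, projSq]
    rw [hQt j i]; ring
  have h2 : ∑ i, ∑ j, Real.exp (l i) * Real.exp (l j) *
        (∑ k, Q i k * (Real.exp (l k) * z k) * Q k j) ^ 2
      = (D * (Q * Z * Q) * (D * (Q * Z * Q))).trace := by
    have h3 : ∀ i j, (Q * Z * Q) i j = ∑ k, Q i k * (Real.exp (l k) * z k) * Q k j := by
      intro i j
      simp [Matrix.mul_apply, Z, Matrix.diagonal_apply]
    have h4 : ∀ i j, (Q * Z * Q) i j = (Q * Z * Q) j i := by
      intro i j
      rw [h3, h3]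
      refine Finset.sum_congr rfl fun k _ => ?_
      rw [hQt i k, hQt k j]; ring
    simp only [Matrix.trace, Matrix.diag, Matrix.mul_apply (N := D * (Q * Z * Q))]
    refine Finset.sum_congr rfl fun i _ => Finset.sum_congr rfl fun j _ => ?_
    rw [← h3]
    simp only [D, Matrix.diagonal_mul]
    rw [h4 j i]; ring
  rw [h1, h2]
  -- Both factors D disappear through Q D Q = Q: one directly, the other after a cyclic shift under
  -- the trace.
  have h5 : D * (Q * Z * Q) * (D * (Q * Z * Q)) = D * (Q * Z * (Q * D * Q) * Z * Q) := by
    simp only [Matrix.mul_assoc]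
  rw [h5, hQ, Matrix.trace_mul_comm D]
  have h6 : Q * Z * Q * Z * Q * D = (Q * Z * Q * Z) * (Q * D) := by
    simp only [Matrix.mul_assoc]
  rw [h6, Matrix.trace_mul_comm _ (Q * D)]
  have h7 : Q * D * (Q * Z * Q * Z) = (Q * D * Q) * Z * Q * Z := by
    simp only [Matrix.mul_assoc]
  rw [h7, hQ, Matrix.mul_assoc (Q * Z), Matrix.mul_assoc Q, Matrix.trace_mul_comm Q]
  simp only [Matrix.mul_assoc]

/-- `∑ᵢⱼₖ zᵢ zⱼ zₖ Pᵢⱼ Pⱼₖ Pₖᵢ` for the orthogonal projection `P`. -/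
def projCube (A : Matrix (Fin m) (Fin n) ℝ) (l z : Fin m → ℝ) : ℝ :=
  ∑ i, ∑ j, Real.exp (l i) * Real.exp (l j) * z i * z j * hat A l i j *
    ∑ k, hat A l i k * (Real.exp (l k) * z k) * hat A l k j

/-- Inserting Q = Q D Q into the trace of (ZQ)³ turns it into a z-weighted sum of nonnegative row
sums. The same row sums with weight 1 add up to the quadratic form of `projSq`, so the cubic term
can be compared with it. -/
theorem projCube_eq (hA : Function.Injective A.mulVec) (l z : Fin m → ℝ) :
    projCube A l z = ∑ i, z i * ∑ j, Real.exp (l i) * Real.exp (l j) *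
        (∑ k, hat A l i k * (Real.exp (l k) * z k) * hat A l k j) ^ 2 := by
  set Q := hat A l with hQdef
  set D := Matrix.diagonal fun i => Real.exp (l i)
  set Z := Matrix.diagonal fun i => Real.exp (l i) * z i
  have hQ : Q * D * Q = Q := hat_mul_diagonal_mul_hat hA l
  have hQt : ∀ i j, Q i j = Q j i := hat_comm hA l
  have h3 : ∀ i j, (Q * Z * Q) i j = ∑ k, Q i k * (Real.exp (l k) * z k) * Q k j := by
    intro i j
    simp [Matrix.mul_apply, Z, Matrix.diagonal_apply]
  have h4 : ∀ i j, (Q * Z * Q) i j = (Q * Z * Q) j i := by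
    intro i j
    rw [h3, h3]
    refine Finset.sum_congr rfl fun k _ => ?_
    rw [hQt i k, hQt k j]; ring
  have h1 : projCube A l z = (Z * Q * (Z * (Q * Z * Q))).trace := by
    rw [projCube]
    simp only [Matrix.trace, Matrix.diag, Matrix.mul_apply (N := Z * (Q * Z * Q))]
    refine Finset.sum_congr rfl fun i _ => Finset.sum_congr rfl fun j _ => ?_
    rw [← hQdef, ← h3]
    simp only [Z, Matrix.diagonal_mul]
    rw [h4 j i]; ring
  have h2 : ∑ i, z i * ∑ j, Real.exp (l i) * Real.exp (l j) *
        (∑ k, Q i k * (Real.exp (l k) * z k) * Q k j) ^ 2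
      = (Z * (Q * Z * Q) * (D * (Q * Z * Q))).trace := by
    simp only [Matrix.trace, Matrix.diag, Matrix.mul_apply (N := D * (Q * Z * Q)), Finset.mul_sum]
    refine Finset.sum_congr rfl fun i _ => Finset.sum_congr rfl fun j _ => ?_
    rw [← h3]
    simp only [Z, D, Matrix.diagonal_mul]
    rw [h4 j i]; ring
  have h5 : Z * (Q * Z * Q) * (D * (Q * Z * Q)) = Z * (Q * Z * (Q * D * Q) * Z * Q) := by
    simp only [Matrix.mul_assoc]
  rw [h1, h2, h5, hQ]
  simp only [Matrix.mul_assoc]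

theorem abs_projCube_le (hA : Function.Injective A.mulVec) (l z : Fin m → ℝ) (c : ℝ)
    (hc : ∀ i, |z i| ≤ c) :
    |projCube A l z| ≤ c * ∑ i, ∑ j, projSq A l i j * z i * z j := by
  rw [projCube_eq hA, sum_projSq_mul_mul hA, Finset.mul_sum]
  refine (Finset.abs_sum_le_sum_abs _ _).trans (Finset.sum_le_sum fun i _ => ?_)
  have h0 : 0 ≤ ∑ j, Real.exp (l i) * Real.exp (l j) *
      (∑ k, hat A l i k * (Real.exp (l k) * z k) * hat A l k j) ^ 2 :=
    Finset.sum_nonneg fun j _ => by positivity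
  rw [abs_mul, abs_of_nonneg h0]
  exact mul_le_mul_of_nonneg_right (hc i) h0

theorem sum_projSq_mul_mul_nonneg (hA : Function.Injective A.mulVec) (l z : Fin m → ℝ) :
    0 ≤ ∑ i, ∑ j, projSq A l i j * z i * z j := by
  rw [sum_projSq_mul_mul hA]
  exact Finset.sum_nonneg fun i _ => Finset.sum_nonneg fun j _ => by positivity

/-- A lower bound for leverage scores in terms of the spread of ℓ, needed for properness of
`lewisMap`. It comes from testing `mulVec_sq_le` with the vector (AᵀA)⁻¹ a_i, whose image under A is
column i of `hat A 0`. -/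
theorem exp_mul_lev_zero_le (hA : NonDegenerate A) (l : Fin m → ℝ) (c : ℝ) (hc : ∀ i, l i ≤ c)
    (i : Fin m) : Real.exp (l i - c) * lev A 0 i ≤ lev A l i := by
  have hinj := hA.injective
  have h0 := hat_self_pos hA 0 i
  have hrow : ∀ j, (A *ᵥ ((expGram A 0)⁻¹ *ᵥ A i)) j = hat A 0 j i := by
    intro j
    rw [Matrix.mulVec_mulVec]
    simp [hat, Matrix.mulVec, Matrix.mul_apply, dotProduct, Matrix.transpose_apply]
  have h1 := mulVec_sq_le hinj l ((expGram A 0)⁻¹ *ᵥ A i) i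
  simp only [hrow] at h1
  have h2 : ∑ j, Real.exp (l j) * hat A 0 j i ^ 2 ≤ Real.exp c * hat A 0 i i := by
    rw [← sum_hat_sq hinj 0 i, Finset.mul_sum]
    refine Finset.sum_le_sum fun j _ => ?_
    rw [hat_comm hinj 0 j i]
    simp only [Pi.zero_apply, Real.exp_zero, one_mul]
    exact mul_le_mul_of_nonneg_right (Real.exp_le_exp.mpr (hc j)) (sq_nonneg _)
  have h3 : hat A 0 i i ^ 2 ≤ hat A l i i * (Real.exp c * hat A 0 i i) :=
    h1.trans (mul_le_mul_of_nonneg_left h2 (hat_self_nonneg hinj l i))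
  have h4 : hat A 0 i i ≤ hat A l i i * Real.exp c := by
    refine le_of_mul_le_mul_right ?_ h0
    calc _ = hat A 0 i i ^ 2 := by ring
      _ ≤ _ := h3
      _ = _ := by ring
  have h5 : Real.exp (l i - c) = Real.exp (l i) * Real.exp (-c) := by
    rw [← Real.exp_add]; rfl
  have h6 : Real.exp c * Real.exp (-c) = 1 := by rw [← Real.exp_add]; simp
  simp only [lev, Pi.zero_apply, Real.exp_zero, one_mul]
  rw [h5, mul_assoc]
  refine mul_le_mul_of_nonneg_left ?_ (Real.exp_pos _).le
  calc Real.exp (-c) * hat A 0 i i ≤ Real.exp (-c) * (hat A l i i * Real.exp c) :=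
        mul_le_mul_of_nonneg_left h4 (Real.exp_pos _).le
    _ = hat A l i i * (Real.exp c * Real.exp (-c)) := by ring
    _ = _ := by rw [h6, mul_one]

/-- The tangent plane inequality for the concave function `log det`. -/
theorem log_det_le_trace {G N : Matrix (Fin n) (Fin n) ℝ} (hG : G.PosDef) (hN : N.PosDef) :
    Real.log N.det ≤ Real.log G.det + (G⁻¹ * N).trace - n := by
  -- Conjugating N by B gives a positive definite matrix with trace tr(G⁻¹N) and determinant det N /
  -- det G; log t ≤ t - 1 is then summed over its eigenvalues.
  obtain ⟨B, hB⟩ : ∃ B : Matrix (Fin n) (Fin n) ℝ, G⁻¹ = Bᵀ * B := by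
    open scoped MatrixOrder in
    obtain ⟨B, hB⟩ := CStarAlgebra.nonneg_iff_eq_star_mul_self.mp hG.inv.posSemidef.nonneg
    exact ⟨B, by rw [hB, Matrix.star_eq_conjTranspose, Matrix.conjTranspose_eq_transpose_of_trivial]⟩
  have hGu : IsUnit G.det := hG.det_pos.ne'.isUnit
  have hdet : B.det * B.det * G.det = 1 := by
    have h1 : (G⁻¹ * G).det = 1 := by rw [Matrix.nonsing_inv_mul _ hGu, Matrix.det_one]
    rwa [hB, Matrix.det_mul, Matrix.det_mul, Matrix.det_transpose] at h1
  have hB0 : B.det ≠ 0 := by rintro h; simp [h] at hdet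
  have hM : (B * N * Bᵀ).PosDef := by
    have := hN.conjTranspose_mul_mul_same (B := Bᵀ)
      (Matrix.mulVec_injective_of_det_ne_zero (by rwa [Matrix.det_transpose]))
    rwa [Matrix.conjTranspose_eq_transpose_of_trivial, Matrix.transpose_transpose] at this
  have htr : (B * N * Bᵀ).trace = (G⁻¹ * N).trace := by
    rw [Matrix.trace_mul_comm, ← Matrix.mul_assoc, hB]
  have hdetM : (B * N * Bᵀ).det = N.det / G.det := by
    rw [Matrix.det_mul, Matrix.det_mul, Matrix.det_transpose, eq_div_iff hG.det_pos.ne']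
    linear_combination N.det * hdet
  have hkey : Real.log (B * N * Bᵀ).det ≤ (B * N * Bᵀ).trace - n := by
    rw [hM.isHermitian.det_eq_prod_eigenvalues, hM.isHermitian.trace_eq_sum_eigenvalues]
    simp only [RCLike.ofReal_real_eq_id, id]
    rw [Real.log_prod (fun i _ => (hM.eigenvalues_pos i).ne')]
    calc ∑ i, Real.log (hM.isHermitian.eigenvalues i)
        ≤ ∑ i, (hM.isHermitian.eigenvalues i - 1) :=
          Finset.sum_le_sum fun i _ => Real.log_le_sub_one_of_pos (hM.eigenvalues_pos i)
      _ = _ := by simp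
  rw [hdetM, htr, Real.log_div hN.det_pos.ne' hG.det_pos.ne'] at hkey
  linarith

/-- The tangent plane inequality for `log det` in the diagonal weights. -/
theorem log_det_gram_le (hA : Function.Injective A.mulVec) (l c : Fin m → ℝ)
    (hc : ∀ i, 0 ≤ c i) (hdet : 0 < (Aᵀ * Matrix.diagonal c * A).det) :
    Real.log (Aᵀ * Matrix.diagonal c * A).det ≤ logDet A l + ∑ i, c i * hat A l i i - n := by
  -- Zero weights are allowed here, so definiteness is read off from semidefiniteness and the
  -- nonzero determinant.
  have hN : (Aᵀ * Matrix.diagonal c * A).PosDef := by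
    have h1 : (Aᵀ * Matrix.diagonal c * A).PosSemidef := by
      have := (Matrix.PosSemidef.diagonal (d := c) hc).conjTranspose_mul_mul_same A
      rwa [Matrix.conjTranspose_eq_transpose_of_trivial] at this
    exact h1.posDef_iff_isUnit.mpr ((Matrix.isUnit_iff_isUnit_det _).mpr hdet.ne'.isUnit)
  have h := log_det_le_trace (expGram_posDef hA l) hN
  have htr : ((expGram A l)⁻¹ * (Aᵀ * Matrix.diagonal c * A)).trace = ∑ i, c i * hat A l i i := by
    rw [Matrix.mul_assoc Aᵀ, ← Matrix.mul_assoc, Matrix.trace_mul_comm, Matrix.mul_assoc,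
      ← Matrix.mul_assoc A]
    simp [Matrix.trace, Matrix.diagonal_mul, hat]
  rw [htr] at h
  exact h

theorem logDet_le (hA : Function.Injective A.mulVec) (l l' : Fin m → ℝ) :
    logDet A l' ≤ logDet A l + ∑ i, Real.exp (l' i) * hat A l i i - n :=
  log_det_gram_le hA l _ (fun _ => (Real.exp_pos _).le) (expGram_posDef hA l').det_pos

end

/-! ### Smoothness, derivatives and convexity in the log-weights -/

section

variable {m n : ℕ} {A : Matrix (Fin m) (Fin n) ℝ}

theorem contDiff_det {E : Type*} [NormedAddCommGroup E] [NormedSpace ℝ E] {k : WithTop ℕ∞}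
    {M : E → Matrix (Fin n) (Fin n) ℝ} (hM : ∀ i j, ContDiff ℝ k fun x => M x i j) :
    ContDiff ℝ k fun x => (M x).det := by
  simp only [Matrix.det_apply]
  exact ContDiff.sum fun σ _ => (contDiff_prod fun i _ => hM _ _).const_smul _

/-- Cramer's rule reduces the entries of the inverse to determinants. -/
theorem contDiff_inv_apply {E : Type*} [NormedAddCommGroup E] [NormedSpace ℝ E] {k : WithTop ℕ∞}
    {M : E → Matrix (Fin n) (Fin n) ℝ} (hM : ∀ i j, ContDiff ℝ k fun x => M x i j)
    (hdet : ∀ x, (M x).det ≠ 0) (i j : Fin n) : ContDiff ℝ k fun x => (M x)⁻¹ i j := by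
  have h : (fun x => (M x)⁻¹ i j) =
      fun x => (M x).det⁻¹ * ((M x).updateRow j (Pi.single i 1)).det := by
    funext x
    rw [Matrix.inv_def, Ring.inverse_eq_inv', Matrix.smul_apply, Matrix.adjugate_apply, smul_eq_mul]
  rw [h]
  refine ((contDiff_det hM).inv hdet).mul (contDiff_det fun a c => ?_)
  by_cases hac : a = j
  · subst hac
    simp only [Matrix.updateRow_self]
    exact contDiff_const
  · simp only [Matrix.updateRow_ne hac]
    exact hM a c

theorem contDiff_expGram_apply {k : WithTop ℕ∞} (i j : Fin n) :
    ContDiff ℝ k fun l => expGram A l i j := by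
  simp only [expGram, Matrix.mul_apply (N := A), Matrix.mul_diagonal]
  fun_prop

theorem contDiff_hat_apply (hA : Function.Injective A.mulVec) {k : WithTop ℕ∞} (i j : Fin m) :
    ContDiff ℝ k fun l => hat A l i j := by
  have h := contDiff_inv_apply (k := k) (M := expGram A) contDiff_expGram_apply
    (fun l => (expGram_posDef hA l).det_pos.ne')
  simp only [hat, Matrix.mul_apply]
  exact ContDiff.sum fun a _ => (ContDiff.sum fun c _ => contDiff_const.mul (h c a)).mul
    contDiff_const

theorem contDiff_lev (hA : Function.Injective A.mulVec) {k : WithTop ℕ∞} (i : Fin m) :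
    ContDiff ℝ k fun l => lev A l i := by
  have := contDiff_hat_apply hA (k := k) i i
  unfold lev
  fun_prop

theorem contDiff_logDet (hA : Function.Injective A.mulVec) {k : WithTop ℕ∞} :
    ContDiff ℝ k (logDet A) :=
  (contDiff_det contDiff_expGram_apply).log fun l => (expGram_posDef hA l).det_pos.ne'

/-- The resolvent identity Q' = Q - Q (D' - D) Q'. It lets Q be differentiated without
differentiating a matrix inverse. -/
theorem hat_apply_eq (hA : Function.Injective A.mulVec) (l l' : Fin m → ℝ) (i j : Fin m) :
    hat A l' i j = hat A l i j -
      ∑ k, hat A l i k * (Real.exp (l' k) - Real.exp (l k)) * hat A l' k j := by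
  have h1 : hat A l * Matrix.diagonal (fun i => Real.exp (l' i)) * hat A l' = hat A l := by
    have h := congrArg Matrix.transpose (hat_mul_diagonal_mul hA l')
    rw [Matrix.transpose_mul, Matrix.transpose_mul, hat_transpose hA, Matrix.diagonal_transpose] at h
    calc hat A l * Matrix.diagonal (fun i => Real.exp (l' i)) * hat A l'
        = A * (expGram A l)⁻¹ *
            (Aᵀ * (Matrix.diagonal (fun i => Real.exp (l' i)) * hat A l')) := by
          simp only [hat, Matrix.mul_assoc]
      _ = hat A l := by rw [h, ← hat]
  have h2 : hat A l * Matrix.diagonal (fun i => Real.exp (l i)) * hat A l' = hat A l' := by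
    calc hat A l * Matrix.diagonal (fun i => Real.exp (l i)) * hat A l'
        = (hat A l * Matrix.diagonal (fun i => Real.exp (l i)) * A) * ((expGram A l')⁻¹ * Aᵀ) := by
          simp only [hat, Matrix.mul_assoc]
      _ = hat A l' := by rw [hat_mul_diagonal_mul hA, ← Matrix.mul_assoc, ← hat]
  have e1 := congrFun (congrFun h1 i) j
  have e2 := congrFun (congrFun h2 i) j
  simp only [Matrix.mul_apply (N := hat A l'), Matrix.mul_diagonal] at e1 e2
  simp only [mul_sub, sub_mul, Finset.sum_sub_distrib]
  rw [e1, e2]; ring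

section Curve

variable {l : ℝ → Fin m → ℝ} {z : Fin m → ℝ} {t : ℝ}

theorem hasDerivAt_hat (hA : Function.Injective A.mulVec) (hl : HasDerivAt l z t) (i j : Fin m) :
    HasDerivAt (fun r => hat A (l r) i j)
      (-∑ k, hat A (l t) i k * (Real.exp (l t k) * z k) * hat A (l t) k j) t := by
  have hc : ∀ k, HasDerivAt (fun r => l r k) (z k) t := hasDerivAt_pi.mp hl
  have hd : ∀ k, DifferentiableAt ℝ (fun r => hat A (l r) k j) t := fun k =>
    (((contDiff_hat_apply hA (k := 1) k j).differentiable one_ne_zero) (l t)).comp t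
      hl.differentiableAt
  have h : (fun r => hat A (l r) i j) = fun r => hat A (l t) i j -
      ∑ k, hat A (l t) i k * (Real.exp (l r k) - Real.exp (l t k)) * hat A (l r) k j :=
    funext fun r => hat_apply_eq hA (l t) (l r) i j
  rw [h]
  -- The factor e^{ℓ(r)} - e^{ℓ(t)} vanishes at r = t, so the unknown derivative of the other factor
  -- drops out.
  have h2 := (HasDerivAt.fun_sum (u := Finset.univ) fun k _ =>
    ((((hc k).exp.sub_const (Real.exp (l t k))).const_mul (hat A (l t) i k)).mul
      (hd k).hasDerivAt)).const_sub (hat A (l t) i j)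
  refine h2.congr_deriv (congrArg Neg.neg ?_)
  exact Finset.sum_congr rfl fun k _ => by ring

theorem hasDerivAt_logDet (hA : Function.Injective A.mulVec) (hl : HasDerivAt l z t) :
    HasDerivAt (fun r => logDet A (l r)) (∑ i, lev A (l t) i * z i) t := by
  have hc : ∀ k, HasDerivAt (fun r => l r k) (z k) t := hasDerivAt_pi.mp hl
  have hd : DifferentiableAt ℝ (fun r => logDet A (l r)) t :=
    ((contDiff_logDet hA (k := 1)).differentiable one_ne_zero (l t)).comp t hl.differentiableAt
  have hs : HasDerivAt (fun r => ∑ i, Real.exp (l r i) * hat A (l t) i i)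
      (∑ i, lev A (l t) i * z i) t := by
    have := HasDerivAt.fun_sum (u := Finset.univ) fun i _ =>
      ((hc i).exp.mul_const (hat A (l t) i i))
    refine this.congr_deriv ?_
    exact Finset.sum_congr rfl fun k _ => by rw [lev]; ring
  -- The tangent plane bound touches at r = t, so the difference has a minimum there and the two
  -- derivatives coincide.
  have hmin : IsLocalMin (fun r => (∑ i, Real.exp (l r i) * hat A (l t) i i) - logDet A (l r)) t := by
    refine Filter.Eventually.of_forall fun r => ?_
    have h1 := logDet_le hA (l t) (l r)
    have h2 : ∑ i, Real.exp (l t i) * hat A (l t) i i = n := sum_lev hA (l t)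
    simp only [h2]
    linarith
  have h0 := hmin.hasDerivAt_eq_zero (hs.sub hd.hasDerivAt)
  have h1 := hd.hasDerivAt
  rwa [← sub_eq_zero.mp h0] at h1

theorem hasDerivAt_lev (hA : Function.Injective A.mulVec) (hl : HasDerivAt l z t) (i : Fin m) :
    HasDerivAt (fun r => lev A (l r) i)
      (lev A (l t) i * z i - ∑ j, projSq A (l t) i j * z j) t := by
  have hc : ∀ k, HasDerivAt (fun r => l r k) (z k) t := hasDerivAt_pi.mp hl
  have h := (hc i).exp.mul (hasDerivAt_hat hA hl i i)
  refine h.congr_deriv ?_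
  rw [lev, mul_neg, Finset.mul_sum, ← sub_eq_add_neg]
  congr 1
  · ring
  · refine Finset.sum_congr rfl fun j _ => ?_
    rw [projSq, hat_comm hA _ j i]; ring

theorem hasDerivAt_projSq (hA : Function.Injective A.mulVec) (hl : HasDerivAt l z t)
    (i j : Fin m) :
    HasDerivAt (fun r => projSq A (l r) i j)
      (projSq A (l t) i j * (z i + z j) - 2 * (Real.exp (l t i) * Real.exp (l t j) *
        hat A (l t) i j * ∑ k, hat A (l t) i k * (Real.exp (l t k) * z k) * hat A (l t) k j)) t := by
  have hc : ∀ k, HasDerivAt (fun r => l r k) (z k) t := hasDerivAt_pi.mp hl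
  have h := ((hc i).exp.mul (hc j).exp).mul ((hasDerivAt_hat hA hl i j).pow 2)
  refine h.congr_deriv ?_
  simp only [projSq, Pi.mul_apply, Pi.pow_apply]
  push_cast
  ring

end Curve

/-- The Hessian of `logDet` is positive semidefinite. -/
theorem sum_projSq_mul_mul_le (hA : Function.Injective A.mulVec) (l z : Fin m → ℝ) :
    ∑ i, ∑ j, projSq A l i j * z i * z j ≤ ∑ i, lev A l i * z i ^ 2 := by
  have h1 : ∑ i, lev A l i * z i ^ 2 = ∑ i, ∑ j, projSq A l i j * z i ^ 2 :=
    Finset.sum_congr rfl fun i _ => by rw [← sum_projSq hA, Finset.sum_mul]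
  have h2 : ∑ i, lev A l i * z i ^ 2 = ∑ i, ∑ j, projSq A l i j * z j ^ 2 := by
    rw [h1, Finset.sum_comm]
    exact Finset.sum_congr rfl fun i _ => Finset.sum_congr rfl fun j _ => by
      rw [projSq_comm hA]
  have h3 : 0 ≤ ∑ i, ∑ j, projSq A l i j * (z i - z j) ^ 2 :=
    Finset.sum_nonneg fun i _ => Finset.sum_nonneg fun j _ =>
      mul_nonneg (projSq_nonneg l i j) (sq_nonneg _)
  -- W - R is the Laplacian of the symmetric nonnegative weights R_ij, because W holds the row sums
  -- of R.
  have h4 : ∑ i, ∑ j, projSq A l i j * (z i - z j) ^ 2 =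
      ∑ i, ∑ j, projSq A l i j * z i ^ 2 + ∑ i, ∑ j, projSq A l i j * z j ^ 2
        - 2 * ∑ i, ∑ j, projSq A l i j * z i * z j := by
    simp only [Finset.mul_sum, ← Finset.sum_add_distrib, ← Finset.sum_sub_distrib]
    exact Finset.sum_congr rfl fun i _ => Finset.sum_congr rfl fun j _ => by ring
  rw [h4, ← h1, ← h2] at h3
  linarith

/-- The tangent plane inequality for the convex function `logDet`. -/
theorem logDet_ge (hA : Function.Injective A.mulVec) (l l' : Fin m → ℝ) :
    logDet A l + ∑ i, lev A l i * (l' i - l i) ≤ logDet A l' := by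
  set c : ℝ → Fin m → ℝ := fun r => l + r • (l' - l) with hc
  have hcd : ∀ r, HasDerivAt c (l' - l) r := fun r => by
    refine (((hasDerivAt_id r).smul_const (l' - l)).const_add l).congr_deriv ?_
    rw [one_smul]
  have h1 : ∀ r, HasDerivAt (fun r => logDet A (c r)) (∑ i, lev A (c r) i * (l' - l) i) r :=
    fun r => hasDerivAt_logDet hA (hcd r)
  have h2 : ∀ r, HasDerivAt (fun r => ∑ i, lev A (c r) i * (l' - l) i)
      (∑ i, (lev A (c r) i * (l' - l) i - ∑ j, projSq A (c r) i j * (l' - l) j) * (l' - l) i) r :=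
    fun r => HasDerivAt.fun_sum fun i _ => (hasDerivAt_lev hA (hcd r) i).mul_const _
  have hconv : ConvexOn ℝ Set.univ fun r => logDet A (c r) := by
    refine convexOn_of_hasDerivWithinAt2_nonneg convex_univ
      (fun r _ => (h1 r).continuousAt.continuousWithinAt)
      (fun r _ => (h1 r).hasDerivWithinAt) (fun r _ => (h2 r).hasDerivWithinAt) fun r _ => ?_
    have h := sum_projSq_mul_mul_le hA (c r) (l' - l)
    rw [← sub_nonneg, ← Finset.sum_sub_distrib] at h
    refine h.trans_eq (Finset.sum_congr rfl fun i _ => ?_)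
    rw [sub_mul, Finset.sum_mul]
    congr 1
    · ring
    · exact Finset.sum_congr rfl fun j _ => by ring
  have h := hconv.le_slope_of_hasDerivAt (Set.mem_univ 0) (Set.mem_univ 1) one_pos (h1 0)
  simp only [hc, slope_def_field] at h
  simp at h
  linarith

end

/-! ### Norm comparisons and the bound on the cubic form -/

section

variable {m n : ℕ} {A : Matrix (Fin m) (Fin n) ℝ}

/-- If `yᵢ² ≤ wᵢ^(2/q) ∑ⱼ wⱼ^(1-2/q) yⱼ²` for all `i`, then the weighted `ℓ²` norm with weights `w`
controls the sup norm up to the factor `m^(1/(q+2))`. -/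
theorem sq_le_rpow_mul_sum {q : ℝ} (hq : 0 < q) {w y : Fin m → ℝ} (hw : ∀ i, 0 < w i)
    (hy : ∀ i, y i ^ 2 ≤ w i ^ (2 / q) * ∑ j, w j ^ (1 - 2 / q) * y j ^ 2) (i : Fin m) :
    y i ^ 2 ≤ (m : ℝ) ^ (2 / (q + 2)) * ∑ j, w j * y j ^ 2 := by
  set E := ∑ j, w j ^ (1 - 2 / q) * y j ^ 2 with hE
  set Z := ∑ j, w j * y j ^ 2 with hZ
  -- The exponent for which w^{1-2/q} = w^r (w^{-2/q})^{1-r}. Each term of E then splits into a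
  -- power of w y² and a power of a quantity that the hypothesis bounds by E.
  set r := q / (q + 2) with hr
  have hq2 : 0 < q + 2 := by linarith
  have hr0 : 0 < r := div_pos hq hq2
  have hr1 : 1 - r = 2 / (q + 2) := by rw [hr]; field_simp; ring
  have hr2 : 0 < 1 - r := by rw [hr1]; positivity
  have hE0 : 0 ≤ E := Finset.sum_nonneg fun j _ => by have := hw j; positivity
  have hZ0 : 0 ≤ Z := Finset.sum_nonneg fun j _ => by have := hw j; positivity
  rcases hE0.eq_or_lt with hE1 | hE1
  · have h := hy i
    rw [← hE1, mul_zero] at h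
    exact h.trans (by positivity)
  have hterm : ∀ j, w j ^ (1 - 2 / q) * y j ^ 2 ≤ (w j * y j ^ 2) ^ r * E ^ (1 - r) := by
    intro j
    have hwj := hw j
    rcases eq_or_ne (y j) 0 with h0 | h0
    · rw [h0]; simp; positivity
    have hy2 : 0 < y j ^ 2 := by positivity
    have h1 : w j ^ (-(2 / q)) * y j ^ 2 ≤ E := by
      rw [Real.rpow_neg hwj.le, inv_mul_le_iff₀ (by positivity)]
      exact hy j
    have h2 : (w j ^ (-(2 / q)) * y j ^ 2) ^ (1 - r) ≤ E ^ (1 - r) :=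
      Real.rpow_le_rpow (by positivity) h1 hr2.le
    refine le_trans (le_of_eq ?_) (mul_le_mul_of_nonneg_left h2 (by positivity))
    rw [Real.mul_rpow hwj.le hy2.le, Real.mul_rpow (by positivity) hy2.le, ← Real.rpow_mul hwj.le]
    have e1 : (y j ^ 2) ^ r * (y j ^ 2) ^ (1 - r) = y j ^ 2 := by
      rw [← Real.rpow_add hy2]; simp
    have e2 : w j ^ r * w j ^ (-(2 / q) * (1 - r)) = w j ^ (1 - 2 / q) := by
      rw [← Real.rpow_add hwj]
      congr 1
      rw [hr1, hr]; field_simp; ring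
    calc _ = (w j ^ r * w j ^ (-(2 / q) * (1 - r))) * ((y j ^ 2) ^ r * (y j ^ 2) ^ (1 - r)) := by
          rw [e1, e2]
      _ = _ := by ring
  have hsum : ∑ j, (w j * y j ^ 2) ^ r ≤ (m : ℝ) ^ (1 - r) * Z ^ r := by
    have h := Real.inner_le_weight_mul_Lp_of_nonneg (Finset.univ : Finset (Fin m)) (p := r⁻¹)
      ((one_le_inv₀ hr0).mpr (by linarith)) (fun _ => 1) (fun j => (w j * y j ^ 2) ^ r)
      (fun _ => zero_le_one) (fun j => by have := hw j; positivity)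
    simp only [one_mul, inv_inv, Finset.sum_const, Finset.card_univ, Fintype.card_fin,
      nsmul_eq_mul, mul_one] at h
    refine h.trans_eq ?_
    congr 2
    refine Finset.sum_congr rfl fun j _ => ?_
    have := hw j
    exact Real.rpow_rpow_inv (by positivity) hr0.ne'
  -- E appears on both sides to the powers 1 and 1 - r; dividing leaves a bound on E^r by Z alone.
  have hEr : E ^ r ≤ (m : ℝ) ^ (1 - r) * Z ^ r := by
    have h1 : E ≤ ((m : ℝ) ^ (1 - r) * Z ^ r) * E ^ (1 - r) := by
      calc E ≤ ∑ j, (w j * y j ^ 2) ^ r * E ^ (1 - r) := Finset.sum_le_sum fun j _ => hterm j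
        _ = (∑ j, (w j * y j ^ 2) ^ r) * E ^ (1 - r) := by rw [Finset.sum_mul]
        _ ≤ _ := mul_le_mul_of_nonneg_right hsum (by positivity)
    have h2 : E = E ^ r * E ^ (1 - r) := by rw [← Real.rpow_add hE1]; simp
    refine le_of_mul_le_mul_right ?_ (Real.rpow_pos_of_pos hE1 (1 - r))
    rw [← h2]; exact h1
  have hwi := hw i
  rcases eq_or_ne (y i) 0 with h0 | h0
  · rw [h0]; simp; positivity
  have hy2 : 0 < y i ^ 2 := by positivity
  have h3 : (y i ^ 2) ^ r ≤ w i ^ (1 - r) * E ^ r := by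
    have h := Real.rpow_le_rpow hy2.le (hy i) hr0.le
    rw [Real.mul_rpow (by positivity) hE0, ← Real.rpow_mul hwi.le] at h
    have e : 2 / q * r = 1 - r := by rw [hr1, hr]; field_simp
    rwa [e] at h
  have h4 : (w i * y i ^ 2) ^ (1 - r) ≤ Z ^ (1 - r) := by
    refine Real.rpow_le_rpow (by positivity) ?_ hr2.le
    exact Finset.single_le_sum (f := fun j => w j * y j ^ 2)
      (fun j _ => by have := hw j; positivity) (Finset.mem_univ i)
  rw [← hr1]
  calc y i ^ 2 = (y i ^ 2) ^ r * (y i ^ 2) ^ (1 - r) := by rw [← Real.rpow_add hy2]; simp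
    _ ≤ (w i ^ (1 - r) * E ^ r) * (y i ^ 2) ^ (1 - r) :=
        mul_le_mul_of_nonneg_right h3 (by positivity)
    _ = (w i * y i ^ 2) ^ (1 - r) * E ^ r := by rw [Real.mul_rpow hwi.le hy2.le]; ring
    _ ≤ Z ^ (1 - r) * ((m : ℝ) ^ (1 - r) * Z ^ r) :=
        mul_le_mul h4 hEr (by positivity) (by positivity)
    _ = (m : ℝ) ^ (1 - r) * (Z ^ r * Z ^ (1 - r)) := by ring
    _ = (m : ℝ) ^ (1 - r) * Z := by
        rw [← Real.rpow_add' hZ0 (by simp)]; simp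

theorem sum_mul_abs_mul_abs_le {ι : Type*} [Fintype ι] {w f g : ι → ℝ} (hw : ∀ i, 0 ≤ w i) :
    ∑ i, w i * (|f i| * |g i|) ≤ √(∑ i, w i * f i ^ 2) * √(∑ i, w i * g i ^ 2) := by
  rw [← Real.sqrt_mul (Finset.sum_nonneg fun i _ => mul_nonneg (hw i) (sq_nonneg _))]
  refine Real.le_sqrt_of_sq_le ?_
  apply Finset.sum_sq_le_sum_mul_sum_of_sq_le_mul
  · exact fun i _ => mul_nonneg (hw i) (sq_nonneg _)
  · exact fun i _ => mul_nonneg (hw i) (sq_nonneg _)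
  · intro i _
    rw [mul_pow, mul_pow, sq_abs, sq_abs]
    apply le_of_eq; ring

/-- `∑ wᵢ |aᵢ| |fᵢ| |gᵢ| ≤ C ‖f‖_w ‖g‖_w` when `|a| ≤ C`. -/
theorem abs_sum_mul_le {ι : Type*} [Fintype ι] {w a f g : ι → ℝ} {C : ℝ} (hw : ∀ i, 0 ≤ w i)
    (ha : ∀ i, |a i| ≤ C) (hC : 0 ≤ C) :
    |∑ i, w i * (a i * f i * g i)| ≤ C * (√(∑ i, w i * f i ^ 2) * √(∑ i, w i * g i ^ 2)) := by
  refine (Finset.abs_sum_le_sum_abs _ _).trans ?_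
  refine le_trans ?_ (mul_le_mul_of_nonneg_left (sum_mul_abs_mul_abs_le hw) hC)
  rw [Finset.mul_sum]
  refine Finset.sum_le_sum fun i _ => ?_
  rw [abs_mul, abs_mul, abs_mul, abs_of_nonneg (hw i)]
  calc w i * (|a i| * |f i| * |g i|) = |a i| * (w i * (|f i| * |g i|)) := by ring
    _ ≤ C * (w i * (|f i| * |g i|)) :=
      mul_le_mul_of_nonneg_right (ha i) (mul_nonneg (hw i) (by positivity))

theorem rpow_three_halves {a : ℝ} (ha : 0 ≤ a) : a ^ (3 / 2 : ℝ) = √a ^ 3 := by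
  rw [Real.sqrt_eq_rpow, ← Real.rpow_natCast, ← Real.rpow_mul ha]
  norm_num

/-- The coefficient of the sup norm of y in the third-derivative bound. Completing a square in
1/√(q+1) bounds the left side by 6q + 4, and with s = √(q+2) the gap 2s³ - (6q + 4) equals
2(s-2)²(s+1). -/
theorem concordance_coeff_left {q d : ℝ} (hq : 0 < q) (hd : d = q / √(q + 1)) :
    3 * d + 2 + d ^ 2 + 4 * q ≤ 2 * (q + 2) ^ (3 / 2 : ℝ) := by
  set τ := √(q + 1) with hτ
  have hτ2 : τ ^ 2 = q + 1 := Real.sq_sqrt (by linarith)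
  have hτ0 : 0 < τ := Real.sqrt_pos.mpr (by linarith)
  have hd2 : d ^ 2 = q ^ 2 / (q + 1) := by rw [hd, div_pow, hτ2]
  have h1 : 3 * d ≤ q + 9 / 4 * (q / (q + 1)) := by
    have h : 3 / τ ≤ 1 + 9 / 4 * (1 / τ ^ 2) := by
      have : 0 ≤ (1 - 3 / 2 * (1 / τ)) ^ 2 := sq_nonneg _
      have e : (1 - 3 / 2 * (1 / τ)) ^ 2 = 1 + 9 / 4 * (1 / τ ^ 2) - 3 / τ := by
        field_simp; ring
      linarith
    rw [hτ2] at h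
    have := mul_le_mul_of_nonneg_left h hq.le
    calc 3 * d = q * (3 / τ) := by rw [hd]; ring
      _ ≤ _ := this
      _ = _ := by ring
  have h2 : q + 9 / 4 * (q / (q + 1)) + 2 + q ^ 2 / (q + 1) + 4 * q ≤ 4 + 6 * q := by
    have : 4 + 6 * q - (q + 9 / 4 * (q / (q + 1)) + 2 + q ^ 2 / (q + 1) + 4 * q)
        = (2 + 3 / 4 * q) / (q + 1) := by field_simp; ring
    have h3 : 0 ≤ (2 + 3 / 4 * q) / (q + 1) := by positivity
    linarith
  have h3 : (q + 2) ^ (3 / 2 : ℝ) = √(q + 2) ^ 3 := rpow_three_halves (by linarith)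
  have h4 : 0 ≤ √(q + 2) := Real.sqrt_nonneg _
  have h5 : √(q + 2) ^ 2 = q + 2 := Real.sq_sqrt (by linarith)
  have h6 : 0 ≤ (√(q + 2) - 2) ^ 2 * (√(q + 2) + 1) := by positivity
  rw [hd2, h3]
  nlinarith

/-- The coefficient of the sup norm of z - ρ. With μ = √(max q 2), both d ≤ μ and |q - 2| ≤ μ² hold,
which leaves a cubic inequality valid for μ ≥ 7/5. -/
theorem concordance_coeff_right {q d : ℝ} (hq : 0 < q) (hd : d = q / √(q + 1)) :
    max q 2 * (d ^ 2 / 2 + 3 * d + 4 + 2 * |q - 2|) ≤ 8 * (max q 2) ^ (5 / 2 : ℝ) := by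
  set M := max q 2 with hM
  have hM2 : 2 ≤ M := le_max_right _ _
  have hMq : q ≤ M := le_max_left _ _
  set μ := √M with hμ
  have hμ2 : μ ^ 2 = M := Real.sq_sqrt (by linarith)
  have hμ0 : 0 ≤ μ := Real.sqrt_nonneg _
  have hμ1 : 7 / 5 ≤ μ := Real.le_sqrt_of_sq_le (by norm_num; linarith)
  have hd2 : d ^ 2 = q ^ 2 / (q + 1) := by rw [hd, div_pow, Real.sq_sqrt (by linarith)]
  have hdq : d ^ 2 ≤ M := by
    rw [hd2, div_le_iff₀ (by linarith)]
    nlinarith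
  have hdμ : d ≤ μ := Real.le_sqrt_of_sq_le hdq
  have habs : |q - 2| ≤ M := abs_le.mpr ⟨by linarith, by linarith⟩
  have h3 : M ^ (5 / 2 : ℝ) = M * μ ^ 3 := by
    rw [hμ, Real.sqrt_eq_rpow, ← Real.rpow_natCast, ← Real.rpow_mul (by linarith)]
    conv_rhs => rw [← Real.rpow_one M, ← Real.rpow_mul (by linarith), ← Real.rpow_add (by linarith)]
    norm_num
  rw [h3]
  have h4 : d ^ 2 / 2 + 3 * d + 4 + 2 * |q - 2| ≤ 8 * μ ^ 3 := by
    have : d ^ 2 / 2 + 3 * d + 4 + 2 * |q - 2| ≤ 5 / 2 * μ ^ 2 + 3 * μ + 4 := by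
      rw [hμ2]; linarith
    nlinarith [mul_nonneg hμ0 (sub_nonneg.mpr hμ1),
      mul_nonneg (mul_nonneg hμ0 hμ0) (sub_nonneg.mpr hμ1)]
  calc M * _ ≤ M * (8 * μ ^ 3) := mul_le_mul_of_nonneg_left h4 (by linarith)
    _ = _ := by ring

/-- The linear relations between the logarithmic derivatives along a line: `y` of the slacks,
`ρ` of the Lewis weights and `z` of the rescaled squared row norms. -/
structure LewisVelocity (A : Matrix (Fin m) (Fin n) ℝ) (q : ℝ) (l y z ρ : Fin m → ℝ) : Prop where
  lev_mul : ∀ i, lev A l i * ρ i = lev A l i * z i - ∑ j, projSq A l i j * z j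
  eq_sub : ∀ i, z i = (1 - 2 / q) * ρ i - 2 * y i

namespace LewisVelocity

variable {q : ℝ} {l y z ρ : Fin m → ℝ}

theorem sum_projSq_mul (hV : LewisVelocity A q l y z ρ) (i : Fin m) :
    ∑ j, projSq A l i j * z j = lev A l i * (z i - ρ i) := by
  have := hV.lev_mul i
  linarith

theorem sum_mul_sub_eq (hV : LewisVelocity A q l y z ρ) :
    ∑ i, lev A l i * (z i * (z i - ρ i)) = ∑ i, ∑ j, projSq A l i j * z i * z j := by
  refine Finset.sum_congr rfl fun i _ => ?_
  calc lev A l i * (z i * (z i - ρ i)) = z i * (lev A l i * (z i - ρ i)) := by ring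
    _ = _ := by
      rw [← hV.sum_projSq_mul i, Finset.mul_sum]
      exact Finset.sum_congr rfl fun j _ => by ring

/-- This is zᵀRz ≥ 0, since W(z - ρ) = Rz. -/
theorem le_sum (hA : Function.Injective A.mulVec) (hV : LewisVelocity A q l y z ρ) :
    ∑ i, lev A l i * (z i * ρ i) ≤ ∑ i, lev A l i * z i ^ 2 := by
  have h := sum_projSq_mul_mul_nonneg hA l z
  rw [← hV.sum_mul_sub_eq] at h
  rw [← sub_nonneg, ← Finset.sum_sub_distrib]
  exact h.trans_eq (Finset.sum_congr rfl fun i _ => by ring)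

/-- With u = z - ρ, the relation Wu = Rz gives ∑wρu = ρᵀRρ + uᵀ(W - R)u, and both terms are
nonnegative. -/
theorem sum_sq_le (hA : Function.Injective A.mulVec) (hV : LewisVelocity A q l y z ρ) :
    ∑ i, lev A l i * ρ i ^ 2 ≤ ∑ i, lev A l i * (z i * ρ i) := by
  set u : Fin m → ℝ := fun i => z i - ρ i with hu
  have h1 := sum_projSq_mul_mul_nonneg hA l ρ
  have h2 := sum_projSq_mul_mul_le hA l u
  have h3 : ∑ i, lev A l i * (ρ i * u i) =
      ∑ i, ∑ j, projSq A l i j * ρ i * ρ j + ∑ i, ∑ j, projSq A l i j * ρ i * u j := by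
    rw [← Finset.sum_add_distrib]
    refine Finset.sum_congr rfl fun i _ => ?_
    rw [← Finset.sum_add_distrib]
    calc lev A l i * (ρ i * u i) = ρ i * (lev A l i * (z i - ρ i)) := by rw [hu]; ring
      _ = _ := by
        rw [← hV.sum_projSq_mul i, Finset.mul_sum]
        exact Finset.sum_congr rfl fun j _ => by rw [hu]; ring
  have h4 : ∑ i, ∑ j, projSq A l i j * ρ i * u j =
      ∑ i, lev A l i * u i ^ 2 - ∑ i, ∑ j, projSq A l i j * u i * u j := by
    rw [Finset.sum_comm, ← Finset.sum_sub_distrib]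
    refine Finset.sum_congr rfl fun i _ => ?_
    calc ∑ j, projSq A l j i * ρ j * u i
        = ∑ j, (u i * (projSq A l i j * z j) - projSq A l i j * u i * u j) :=
          Finset.sum_congr rfl fun j _ => by rw [projSq_comm hA l j i, hu]; ring
      _ = u i * (lev A l i * u i) - ∑ j, projSq A l i j * u i * u j := by
          rw [Finset.sum_sub_distrib, ← Finset.mul_sum, hV.sum_projSq_mul i]
      _ = _ := by ring
  have h5 : 0 ≤ ∑ i, lev A l i * (ρ i * u i) := by rw [h3, h4]; linarith
  rw [← sub_nonneg, ← Finset.sum_sub_distrib]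
  exact h5.trans_eq (Finset.sum_congr rfl fun i _ => by rw [hu]; ring)

/-- Cauchy-Schwarz on w_i (z_i - ρ_i) = ∑_j R_ij z_j, using ∑_j R_ij = w_i and R_ij ≤ w_i w_j. -/
theorem abs_sub_le (hA : NonDegenerate A) (hV : LewisVelocity A q l y z ρ) (i : Fin m) :
    |z i - ρ i| ≤ √(∑ j, lev A l j * z j ^ 2) := by
  have hσ := lev_pos hA l i
  refine Real.le_sqrt_of_sq_le ?_
  rw [sq_abs]
  have h1 : (∑ j, projSq A l i j * z j) ^ 2 ≤
      (∑ j, projSq A l i j) * ∑ j, projSq A l i j * z j ^ 2 := by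
    apply Finset.sum_sq_le_sum_mul_sum_of_sq_le_mul
    · exact fun j _ => projSq_nonneg l i j
    · exact fun j _ => mul_nonneg (projSq_nonneg l i j) (sq_nonneg _)
    · intro j _
      apply le_of_eq; ring
  have h2 : ∑ j, projSq A l i j * z j ^ 2 ≤ lev A l i * ∑ j, lev A l j * z j ^ 2 := by
    rw [Finset.mul_sum]
    refine Finset.sum_le_sum fun j _ => ?_
    rw [← mul_assoc]
    exact mul_le_mul_of_nonneg_right (projSq_le hA.injective l i j) (sq_nonneg _)
  rw [hV.sum_projSq_mul, sum_projSq hA.injective] at h1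
  have h3 := h1.trans (mul_le_mul_of_nonneg_left h2 hσ.le)
  refine le_of_mul_le_mul_left ?_ (pow_pos hσ 2)
  calc _ = (lev A l i * (z i - ρ i)) ^ 2 := by ring
    _ ≤ _ := h3
    _ = _ := by ring

/-- The second derivative of the barrier along the line. -/
def second (A : Matrix (Fin m) (Fin n) ℝ) (l y ρ : Fin m → ℝ) : ℝ :=
  ∑ i, lev A l i * (y i ^ 2 - ρ i * y i)

/-- Eliminating y expresses the second derivative through a = ∑wz², c = ∑wzρ, d = ∑wρ². Since a ≥ c
≥ d ≥ 0, the comparisons that follow are linear inequalities in a, c, d. -/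
theorem four_mul_second (hq : 0 < q) (hV : LewisVelocity A q l y z ρ) :
    4 * q ^ 2 * second A l y ρ = q ^ 2 * ∑ i, lev A l i * z i ^ 2 +
      4 * q * ∑ i, lev A l i * (z i * ρ i) - (q ^ 2 - 4) * ∑ i, lev A l i * ρ i ^ 2 := by
  simp only [second, Finset.mul_sum, ← Finset.sum_add_distrib, ← Finset.sum_sub_distrib]
  refine Finset.sum_congr rfl fun i _ => ?_
  have h : q * z i = (q - 2) * ρ i - 2 * (q * y i) := by
    rw [hV.eq_sub i]; field_simp
  have h1 : q * y i = ((q - 2) * ρ i - q * z i) / 2 := by linarith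
  calc 4 * q ^ 2 * (lev A l i * (y i ^ 2 - ρ i * y i))
      = 4 * lev A l i * ((q * y i) ^ 2 - q * ρ i * (q * y i)) := by ring
    _ = _ := by rw [h1]; ring

theorem sum_sq_nonneg (hA : NonDegenerate A) (l f : Fin m → ℝ) :
    0 ≤ ∑ i, lev A l i * f i ^ 2 :=
  Finset.sum_nonneg fun i _ => mul_nonneg (lev_pos hA l i).le (sq_nonneg _)

/-- In the quantities c = ∑wzρ and d = ∑wρ², the difference of the two sides times 4q² is 2q²(c - d)
+ 4qd. -/
theorem sum_y_sq_le (hA : NonDegenerate A) (hq : 0 < q) (hV : LewisVelocity A q l y z ρ) :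
    ∑ i, lev A l i * y i ^ 2 ≤ second A l y ρ := by
  have h1 := hV.sum_sq_le hA.injective
  have h2 := sum_sq_nonneg hA l ρ
  have h3 := hV.four_mul_second hq
  have h4 : 4 * q ^ 2 * ∑ i, lev A l i * y i ^ 2 = q ^ 2 * ∑ i, lev A l i * z i ^ 2
      - 2 * q * (q - 2) * ∑ i, lev A l i * (z i * ρ i)
      + (q - 2) ^ 2 * ∑ i, lev A l i * ρ i ^ 2 := by
    simp only [Finset.mul_sum, ← Finset.sum_add_distrib, ← Finset.sum_sub_distrib]
    refine Finset.sum_congr rfl fun i _ => ?_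
    have h : q * z i = (q - 2) * ρ i - 2 * (q * y i) := by
      rw [hV.eq_sub i]; field_simp
    have h1 : q * y i = ((q - 2) * ρ i - q * z i) / 2 := by linarith
    calc 4 * q ^ 2 * (lev A l i * y i ^ 2) = 4 * lev A l i * (q * y i) ^ 2 := by ring
      _ = _ := by rw [h1]; ring
  refine le_of_mul_le_mul_left ?_ (by positivity : 0 < 4 * q ^ 2)
  rw [h3, h4]
  nlinarith [mul_nonneg (mul_pos hq hq).le (sub_nonneg.mpr h1), mul_nonneg hq.le h2]

/-- The constant is exact for this method: 4q² times the second derivative minus 4(q+1)d equals q²(a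
- d) + 4q(c - d), with a, c, d as in `four_mul_second`. -/
theorem sum_rho_sq_le (hA : NonDegenerate A) (hq : 0 < q) (hV : LewisVelocity A q l y z ρ) :
    ∑ i, lev A l i * ρ i ^ 2 ≤ q ^ 2 / (q + 1) * second A l y ρ := by
  have h1 := hV.sum_sq_le hA.injective
  have h2 := hV.le_sum hA.injective
  have h3 := hV.four_mul_second hq
  rw [div_mul_eq_mul_div, le_div_iff₀ (by linarith)]
  nlinarith [mul_nonneg hq.le (sub_nonneg.mpr h1),
    mul_nonneg (mul_pos hq hq).le (sub_nonneg.mpr (h1.trans h2))]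

theorem sum_mul_sub_le (hA : NonDegenerate A) (hq : 0 < q) (hV : LewisVelocity A q l y z ρ) :
    ∑ i, lev A l i * (z i * (z i - ρ i)) ≤ 4 * second A l y ρ := by
  have h1 := hV.sum_sq_le hA.injective
  have h2 := sum_sq_nonneg hA l ρ
  have h3 := hV.four_mul_second hq
  have h4 : ∑ i, lev A l i * (z i * (z i - ρ i)) =
      ∑ i, lev A l i * z i ^ 2 - ∑ i, lev A l i * (z i * ρ i) := by
    rw [← Finset.sum_sub_distrib]
    exact Finset.sum_congr rfl fun i _ => by ring
  refine le_of_mul_le_mul_left ?_ (by positivity : 0 < q ^ 2)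
  rw [h4]
  nlinarith [mul_nonneg (mul_pos hq hq).le (sub_nonneg.mpr h1), mul_nonneg hq.le (h2.trans h1)]

theorem sum_sub_sq_le (hA : NonDegenerate A) (hq : 0 < q) (hV : LewisVelocity A q l y z ρ) :
    ∑ i, lev A l i * (z i - ρ i) ^ 2 ≤ 4 * second A l y ρ := by
  have h1 := hV.sum_sq_le hA.injective
  have h2 := sum_sq_nonneg hA l ρ
  have h3 := hV.four_mul_second hq
  have h4 : ∑ i, lev A l i * (z i - ρ i) ^ 2 =
      ∑ i, lev A l i * z i ^ 2 - 2 * ∑ i, lev A l i * (z i * ρ i) + ∑ i, lev A l i * ρ i ^ 2 := by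
    rw [Finset.mul_sum, ← Finset.sum_sub_distrib, ← Finset.sum_add_distrib]
    exact Finset.sum_congr rfl fun i _ => by ring
  refine le_of_mul_le_mul_left ?_ (by positivity : 0 < q ^ 2)
  rw [h4]
  nlinarith [mul_nonneg (mul_pos hq hq).le (sub_nonneg.mpr h1), mul_nonneg hq.le (h2.trans h1)]

theorem sum_z_sq_le (hA : NonDegenerate A) (hq : 0 < q) (hV : LewisVelocity A q l y z ρ) :
    ∑ i, lev A l i * z i ^ 2 ≤ max q 2 ^ 2 * second A l y ρ := by
  have h1 := hV.sum_sq_le hA.injective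
  have h2 := sum_sq_nonneg hA l ρ
  have h3 := hV.four_mul_second hq
  have h4 := hV.le_sum hA.injective
  rcases le_total 2 q with h | h
  · rw [max_eq_left h]
    nlinarith [mul_nonneg (by nlinarith : 0 ≤ q ^ 2 - 4) (sub_nonneg.mpr (h1.trans h4)),
      mul_nonneg hq.le (h2.trans h1)]
  · rw [max_eq_right h]
    refine le_of_mul_le_mul_left ?_ (by positivity : 0 < q ^ 2)
    nlinarith [mul_nonneg (by nlinarith : 0 ≤ 4 - q ^ 2) h2, mul_nonneg hq.le (h2.trans h1)]

/-- The third derivative of the barrier along the line. -/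
def third (A : Matrix (Fin m) (Fin n) ℝ) (q : ℝ) (l y z ρ : Fin m → ℝ) : ℝ :=
  ∑ i, lev A l i * (3 * ρ i * y i ^ 2 - 2 * y i ^ 3 + ρ i ^ 3 / q
    - 3 / 2 * ρ i * (z i - ρ i) ^ 2 - (z i - ρ i) ^ 3) + projCube A l z

/-- In every cubic term one factor is taken in sup norm and two in the weighted ℓ² norm. Each
weighted norm is a multiple of the root S of the second derivative. The available sup bounds are Y =
κ‖y‖_w for y and U = ‖z‖_w for z - ρ. -/
theorem abs_third_le (hA : NonDegenerate A) (hq : 0 < q) (hV : LewisVelocity A q l y z ρ)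
    {κ : ℝ} (hκ : 0 ≤ κ) (hy : ∀ i, |y i| ≤ κ * √(∑ j, lev A l j * y j ^ 2)) :
    |third A q l y z ρ| ≤
      2 * ((q + 2) ^ (3 / 2 : ℝ) * κ + 4 * max q 2 ^ (5 / 2 : ℝ)) * √(second A l y ρ) ^ 3 := by
  have hσ : ∀ i, 0 ≤ lev A l i := fun i => (lev_pos hA l i).le
  set M := max q 2 with hM
  have hM2 : 2 ≤ M := le_max_right _ _
  set H := second A l y ρ with hH
  have hyH := hV.sum_y_sq_le hA hq
  have hH0 : 0 ≤ H := (sum_sq_nonneg hA l y).trans hyH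
  set S := √H with hS
  have hS0 : 0 ≤ S := Real.sqrt_nonneg _
  have hS2 : S ^ 2 = H := Real.sq_sqrt hH0
  set d := q / √(q + 1) with hd
  have hd0 : 0 ≤ d := by positivity
  have hd2 : d ^ 2 = q ^ 2 / (q + 1) := by rw [hd, div_pow, Real.sq_sqrt (by linarith)]
  set e := √(∑ j, lev A l j * y j ^ 2) with he
  set r := √(∑ j, lev A l j * ρ j ^ 2) with hr
  set f := √(∑ j, lev A l j * (z j - ρ j) ^ 2) with hf
  set U := √(∑ j, lev A l j * z j ^ 2) with hU
  have he0 : 0 ≤ e := Real.sqrt_nonneg _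
  have hr0 : 0 ≤ r := Real.sqrt_nonneg _
  have hf0 : 0 ≤ f := Real.sqrt_nonneg _
  have hU0 : 0 ≤ U := Real.sqrt_nonneg _
  have heS : e ≤ S := Real.sqrt_le_sqrt hyH
  have hrS : r ≤ d * S := by
    refine Real.sqrt_le_iff.mpr ⟨by positivity, ?_⟩
    rw [mul_pow, hS2, hd2]
    exact hV.sum_rho_sq_le hA hq
  have hfS : f ≤ 2 * S := by
    refine Real.sqrt_le_iff.mpr ⟨by positivity, ?_⟩
    rw [mul_pow, hS2]
    exact (hV.sum_sub_sq_le hA hq).trans_eq (by ring)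
  have hUS : U ≤ M * S := by
    refine Real.sqrt_le_iff.mpr ⟨by positivity, ?_⟩
    rw [mul_pow, hS2]
    exact hV.sum_z_sq_le hA hq
  set Y := κ * e with hY
  have hY0 : 0 ≤ Y := by positivity
  have hYS : Y ≤ κ * S := mul_le_mul_of_nonneg_left heS hκ
  have hu : ∀ i, |z i - ρ i| ≤ U := hV.abs_sub_le hA
  -- Since z, ρ and y satisfy one linear relation, ρ and z are combinations of y and z - ρ, the two
  -- vectors whose sup norms are controlled.
  have hρ : ∀ i, ρ i / q = -(y i + (z i - ρ i) / 2) := by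
    intro i
    have h := hV.eq_sub i
    field_simp at h ⊢
    linarith
  have hz : ∀ i, z i = -(q * y i) - (q / 2 - 1) * (z i - ρ i) := by
    intro i
    have h := hV.eq_sub i
    field_simp at h ⊢
    linarith
  have hzb : ∀ i, |z i| ≤ q * Y + |q - 2| / 2 * U := by
    intro i
    rw [hz i]
    refine (abs_sub _ _).trans ?_
    rw [abs_neg, abs_mul, abs_mul, abs_of_pos hq]
    have e1 : |q / 2 - 1| = |q - 2| / 2 := by
      rw [show q / 2 - 1 = (q - 2) / 2 by ring, abs_div, abs_of_pos (two_pos : (0 : ℝ) < 2)]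
    rw [e1]
    exact add_le_add (mul_le_mul_of_nonneg_left (hy i) hq.le)
      (mul_le_mul_of_nonneg_left (hu i) (by positivity))
  have hρb : ∀ i, |ρ i / q| ≤ Y + U / 2 := by
    intro i
    rw [hρ i, abs_neg]
    refine (abs_add_le _ _).trans (add_le_add (hy i) ?_)
    rw [abs_div, abs_of_pos (two_pos : (0 : ℝ) < 2)]
    have := hu i
    linarith
  have hT : |projCube A l z| ≤ (q * Y + |q - 2| / 2 * U) * (4 * H) := by
    refine (abs_projCube_le hA.injective l z _ hzb).trans ?_
    rw [← hV.sum_mul_sub_eq]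
    exact mul_le_mul_of_nonneg_left (hV.sum_mul_sub_le hA hq) (by positivity)
  have b1 := abs_sum_mul_le (w := lev A l) (a := y) (f := ρ) (g := y) hσ hy hY0
  have b2 := abs_sum_mul_le (w := lev A l) (a := y) (f := y) (g := y) hσ hy hY0
  have b3 := abs_sum_mul_le (w := lev A l) (a := fun i => ρ i / q) (f := ρ) (g := ρ) hσ hρb
    (by positivity)
  have b4 := abs_sum_mul_le (w := lev A l) (a := fun i => z i - ρ i) (f := ρ)
    (g := fun i => z i - ρ i) hσ hu hU0
  have b5 := abs_sum_mul_le (w := lev A l) (a := fun i => z i - ρ i) (f := fun i => z i - ρ i)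
    (g := fun i => z i - ρ i) hσ hu hU0
  rw [← he, ← hr] at b1
  rw [← he] at b2
  rw [← hr] at b3
  rw [← hf, ← hr] at b4
  rw [← hf] at b5
  have hsplit : third A q l y z ρ =
      3 * ∑ i, lev A l i * (y i * ρ i * y i) - 2 * ∑ i, lev A l i * (y i * y i * y i)
      + ∑ i, lev A l i * (ρ i / q * ρ i * ρ i)
      - 3 / 2 * ∑ i, lev A l i * ((z i - ρ i) * ρ i * (z i - ρ i))
      - ∑ i, lev A l i * ((z i - ρ i) * (z i - ρ i) * (z i - ρ i)) + projCube A l z := by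
    rw [third]
    congr 1
    simp only [Finset.mul_sum, ← Finset.sum_add_distrib, ← Finset.sum_sub_distrib]
    exact Finset.sum_congr rfl fun i _ => by ring
  have hbound : |third A q l y z ρ| ≤ 3 * (Y * (r * e)) + 2 * (Y * (e * e))
      + (Y + U / 2) * (r * r) + 3 / 2 * (U * (r * f)) + U * (f * f)
      + (q * Y + |q - 2| / 2 * U) * (4 * H) := by
    rw [hsplit]
    rw [abs_le] at b1 b2 b3 b4 b5 hT ⊢
    constructor <;> linarith [b1.1, b1.2, b2.1, b2.2, b3.1, b3.2, b4.1, b4.2, b5.1, b5.2, hT.1, hT.2]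
  have hre : r * e ≤ d * S ^ 2 := by
    calc r * e ≤ (d * S) * S := mul_le_mul hrS heS he0 (by positivity)
      _ = _ := by ring
  have hee : e * e ≤ S ^ 2 := by
    calc e * e ≤ S * S := mul_le_mul heS heS he0 hS0
      _ = _ := by ring
  have hrr : r * r ≤ d ^ 2 * S ^ 2 := by
    calc r * r ≤ (d * S) * (d * S) := mul_le_mul hrS hrS hr0 (by positivity)
      _ = _ := by ring
  have hrf : r * f ≤ 2 * d * S ^ 2 := by
    calc r * f ≤ (d * S) * (2 * S) := mul_le_mul hrS hfS hf0 (by positivity)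
      _ = _ := by ring
  have hff : f * f ≤ 4 * S ^ 2 := by
    calc f * f ≤ (2 * S) * (2 * S) := mul_le_mul hfS hfS hf0 (by positivity)
      _ = _ := by ring
  have hbound2 : |third A q l y z ρ| ≤ Y * ((3 * d + 2 + d ^ 2 + 4 * q) * S ^ 2)
      + U * ((d ^ 2 / 2 + 3 * d + 4 + 2 * |q - 2|) * S ^ 2) := by
    refine hbound.trans ?_
    have k1 := mul_le_mul_of_nonneg_left hre hY0
    have k2 := mul_le_mul_of_nonneg_left hee hY0
    have k3 := mul_le_mul_of_nonneg_left hrr (by positivity : 0 ≤ Y + U / 2)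
    have k4 := mul_le_mul_of_nonneg_left hrf hU0
    have k5 := mul_le_mul_of_nonneg_left hff hU0
    rw [← hS2]
    linarith
  have c1 := concordance_coeff_left hq hd
  have c2 := concordance_coeff_right hq hd
  calc |third A q l y z ρ| ≤ _ := hbound2
    _ ≤ (κ * S) * ((2 * (q + 2) ^ (3 / 2 : ℝ)) * S ^ 2)
        + (M * S) * ((d ^ 2 / 2 + 3 * d + 4 + 2 * |q - 2|) * S ^ 2) := by
      refine add_le_add (mul_le_mul hYS ?_ (by positivity) (by positivity))
        (mul_le_mul_of_nonneg_right hUS (by positivity))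
      exact mul_le_mul_of_nonneg_right c1 (by positivity)
    _ = 2 * (q + 2) ^ (3 / 2 : ℝ) * κ * S ^ 3
        + (M * (d ^ 2 / 2 + 3 * d + 4 + 2 * |q - 2|)) * S ^ 3 := by ring
    _ ≤ 2 * (q + 2) ^ (3 / 2 : ℝ) * κ * S ^ 3 + 8 * M ^ (5 / 2 : ℝ) * S ^ 3 := by
      gcongr
    _ = _ := by ring

end LewisVelocity

end

/-! ### The Lewis equation: existence and smooth local solutions -/

section

variable {m n : ℕ} {A : Matrix (Fin m) (Fin n) ℝ} {q : ℝ}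

/-- The Lewis weights for the slacks `s` are the leverage scores of `ℓ` where
`lewisMap A q ℓ = -2 log s`. -/
def lewisMap (A : Matrix (Fin m) (Fin n) ℝ) (q : ℝ) (l : Fin m → ℝ) : Fin m → ℝ :=
  fun i => l i - (1 - 2 / q) * Real.log (lev A l i)

theorem contDiff_lewisMap (hA : NonDegenerate A) {k : WithTop ℕ∞} :
    ContDiff ℝ k (lewisMap A q) := by
  rw [contDiff_pi]
  intro i
  exact (contDiff_apply ℝ ℝ i).sub
    (contDiff_const.mul ((contDiff_lev hA.injective i).log fun l => (lev_pos hA l i).ne'))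

theorem hasDerivAt_lewisMap (hA : NonDegenerate A) {l : ℝ → Fin m → ℝ} {z : Fin m → ℝ} {t : ℝ}
    (hl : HasDerivAt l z t) (i : Fin m) :
    HasDerivAt (fun r => lewisMap A q (l r) i)
      (z i - (1 - 2 / q) * ((lev A (l t) i * z i - ∑ j, projSq A (l t) i j * z j) /
        lev A (l t) i)) t :=
  (hasDerivAt_pi.mp hl i).sub
    (((hasDerivAt_lev hA.injective hl i).log (lev_pos hA (l t) i).ne').const_mul _)

/-- A kernel vector z is a Lewis velocity with y = 0. Its second-derivative form vanishes, and this
form controls ∑wz². -/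
theorem fderiv_lewisMap_injective (hA : NonDegenerate A) (hq : 0 < q) (l : Fin m → ℝ) :
    Function.Injective (fderiv ℝ (lewisMap A q) l) := by
  rw [injective_iff_map_eq_zero]
  intro z hz
  have hline : HasDerivAt (fun r : ℝ => l + r • z) z 0 := by
    refine (((hasDerivAt_id (0 : ℝ)).smul_const z).const_add l).congr_deriv (one_smul _ _)
  have hfd : HasFDerivAt (lewisMap A q) (fderiv ℝ (lewisMap A q) l) (l + (0 : ℝ) • z) := by
    rw [zero_smul, add_zero]
    exact ((contDiff_lewisMap hA (k := 1)).differentiable one_ne_zero l).hasFDerivAt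
  have hcomp := hasDerivAt_pi.mp (hfd.comp_hasDerivAt (0 : ℝ) hline)
  rw [hz] at hcomp
  set ρ : Fin m → ℝ := fun i => (lev A l i * z i - ∑ j, projSq A l i j * z j) / lev A l i with hρ
  have hV : LewisVelocity A q l 0 z ρ := by
    refine ⟨fun i => ?_, fun i => ?_⟩
    · rw [hρ]; exact mul_div_cancel₀ _ (lev_pos hA l i).ne'
    · have h := (hasDerivAt_lewisMap (q := q) hA hline i).unique (hcomp i)
      simp only [zero_smul, add_zero, Pi.zero_apply] at h
      simp only [hρ, Pi.zero_apply]
      linarith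
  have h1 := hV.sum_z_sq_le hA hq
  have h2 : LewisVelocity.second A l 0 ρ = 0 := by simp [LewisVelocity.second]
  rw [h2, mul_zero] at h1
  have h3 := (Finset.sum_eq_zero_iff_of_nonneg
    (fun i _ => mul_nonneg (lev_pos hA l i).le (sq_nonneg (z i)))).mp
    (le_antisymm h1 (LewisVelocity.sum_sq_nonneg hA l z))
  funext i
  have h4 := h3 i (Finset.mem_univ i)
  simpa [(lev_pos hA l i).ne'] using h4

/-- The derivative of `lewisMap` as an invertible map. -/
def lewisMapDeriv (hA : NonDegenerate A) (hq : 0 < q) (l : Fin m → ℝ) :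
    (Fin m → ℝ) ≃L[ℝ] (Fin m → ℝ) :=
  (LinearEquiv.ofInjectiveEndo (fderiv ℝ (lewisMap A q) l : (Fin m → ℝ) →ₗ[ℝ] (Fin m → ℝ))
    (fderiv_lewisMap_injective hA hq l)).toContinuousLinearEquiv

theorem hasStrictFDerivAt_lewisMap (hA : NonDegenerate A) (hq : 0 < q) (l : Fin m → ℝ) :
    HasStrictFDerivAt (lewisMap A q)
      (lewisMapDeriv hA hq l : (Fin m → ℝ) →L[ℝ] (Fin m → ℝ)) l := by
  have h : (lewisMapDeriv hA hq l : (Fin m → ℝ) →L[ℝ] (Fin m → ℝ)) = fderiv ℝ (lewisMap A q) l := by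
    ext z : 1
    rfl
  rw [h]
  exact (contDiff_lewisMap hA (k := 1)).contDiffAt.hasStrictFDerivAt one_ne_zero

/-- Properness of `lewisMap`. At the index i₀ of the largest ℓ, the two-sided bound ℓ_j - ℓ_{i₀} - C
≤ log lev_j ≤ 0 holds for all j. Inserted in ℓ = `lewisMap` + p log lev, it bounds ℓ in both
directions; p < 1 is what allows ℓ_j to be solved for. -/
theorem abs_le_of_lewisMap_le (hA : NonDegenerate A) (hq : 0 < q) {B : ℝ} :
    ∃ K : ℝ, ∀ l, (∀ i, |lewisMap A q l i| ≤ B) → ∀ i, |l i| ≤ K := by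
  set p := 1 - 2 / q with hp
  have hp1 : p < 1 := by rw [hp]; have : 0 < 2 / q := by positivity
                         linarith
  set C := ∑ i, |Real.log (lev A 0 i)| with hC
  have hC0 : 0 ≤ C := Finset.sum_nonneg fun i _ => abs_nonneg _
  have hCi : ∀ i, -C ≤ Real.log (lev A 0 i) := fun i => by
    have h1 : |Real.log (lev A 0 i)| ≤ C :=
      Finset.single_le_sum (f := fun i => |Real.log (lev A 0 i)|) (fun i _ => abs_nonneg _)
        (Finset.mem_univ i)
    exact (abs_le.mp h1).1
  refine ⟨max B ((B * (1 + |p|) + |p| * C) / (1 - p)) + (B + |p| * C), fun l hl i => ?_⟩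
  have hB : 0 ≤ B := (abs_nonneg _).trans (hl i)
  obtain ⟨i₀, -, hi₀⟩ := Finset.exists_max_image Finset.univ l ⟨i, Finset.mem_univ i⟩
  have hlog0 : ∀ j, Real.log (lev A l j) ≤ 0 := fun j =>
    Real.log_nonpos (lev_pos hA l j).le (lev_le_one hA l j)
  have hlog1 : ∀ j, l j - l i₀ - C ≤ Real.log (lev A l j) := by
    intro j
    have h1 := exp_mul_lev_zero_le hA l (l i₀) (fun k => hi₀ k (Finset.mem_univ k)) j
    have h2 := Real.log_le_log (mul_pos (Real.exp_pos _) (lev_pos hA 0 j)) h1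
    rw [Real.log_mul (Real.exp_pos _).ne' (lev_pos hA 0 j).ne', Real.log_exp] at h2
    linarith [hCi j]
  have heq : ∀ j, l j = lewisMap A q l j + p * Real.log (lev A l j) := fun j => by
    rw [lewisMap]; ring
  have hmax0 : 0 ≤ max B ((B * (1 + |p|) + |p| * C) / (1 - p)) := hB.trans (le_max_left _ _)
  have hl1 := fun j => (abs_le.mp (hl j)).1
  have hl2 := fun j => (abs_le.mp (hl j)).2
  have hpC : 0 ≤ |p| * C := by positivity
  -- For p ≥ 0 the bound log lev ≤ 0 gives the upper estimate on ℓ and leverage lower bounds give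
  -- the other; for p ≤ 0 the roles are exchanged.
  rcases le_total 0 p with h0 | h0
  · have hup : ∀ j, l j ≤ B := fun j => by
      rw [heq j]
      have := mul_nonpos_of_nonneg_of_nonpos h0 (hlog0 j)
      linarith [hl2 j]
    have hlow : -((B * (1 + |p|) + |p| * C) / (1 - p)) ≤ l i := by
      rw [neg_le, le_div_iff₀ (by linarith), abs_of_nonneg h0]
      have h1 := mul_le_mul_of_nonneg_left (hlog1 i) h0
      have h2 := mul_le_mul_of_nonneg_left (hup i₀) h0
      have h3 := heq i
      have h4 := hl1 i
      nlinarith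
    have h5 := le_max_left B ((B * (1 + |p|) + |p| * C) / (1 - p))
    have h6 := le_max_right B ((B * (1 + |p|) + |p| * C) / (1 - p))
    exact abs_le.mpr ⟨by linarith, by linarith [hup i]⟩
  · have hlow : -B ≤ l i := by
      have := mul_nonneg_of_nonpos_of_nonpos h0 (hlog0 i)
      linarith [hl1 i, heq i]
    have hup : l i₀ ≤ B + |p| * C := by
      have h1 := mul_le_mul_of_nonpos_left (hlog1 i₀) h0
      rw [abs_of_nonpos h0]
      linarith [hl2 i₀, heq i₀]
    have h7 := hi₀ i (Finset.mem_univ i)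
    exact abs_le.mpr ⟨by linarith, by linarith⟩

/-- Invertible derivatives make the range open and properness makes it closed; ℝ^m is connected. -/
theorem lewisMap_surjective (hA : NonDegenerate A) (hq : 0 < q) :
    Function.Surjective (lewisMap A q) := by
  have hcont : Continuous (lewisMap A q) := (contDiff_lewisMap hA (k := 0)).continuous
  have hopen : IsOpenMap (lewisMap A q) :=
    isOpenMap_of_hasStrictFDerivAt_equiv (hasStrictFDerivAt_lewisMap hA hq)
  have hproper : IsProperMap (lewisMap A q) := by
    rw [isProperMap_iff_isCompact_preimage]
    refine ⟨hcont, fun K hK => ?_⟩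
    obtain ⟨B, hB⟩ := hK.isBounded.exists_norm_le
    obtain ⟨R, hR⟩ := abs_le_of_lewisMap_le (B := B) hA hq
    refine Metric.isCompact_of_isClosed_isBounded (hK.isClosed.preimage hcont) ?_
    refine isBounded_iff_forall_norm_le.mpr ⟨max R 0, fun l hl => ?_⟩
    rw [pi_norm_le_iff_of_nonneg (le_max_right _ _)]
    intro i
    refine (hR l (fun j => ?_) i).trans (le_max_left _ _)
    exact (norm_le_pi_norm (lewisMap A q l) j).trans (hB _ hl)
  rw [← Set.range_eq_univ]
  exact IsClopen.eq_univ ⟨hproper.isClosedMap.isClosed_range, hopen.isOpen_range⟩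
    (Set.range_nonempty _)

theorem exists_local_inverse_lewisMap (hA : NonDegenerate A) (hq : 0 < q) (l : Fin m → ℝ) :
    ∃ g : (Fin m → ℝ) → Fin m → ℝ, ContDiffAt ℝ 3 g (lewisMap A q l) ∧
      ∀ᶠ t in 𝓝 (lewisMap A q l), lewisMap A q (g t) = t := by
  have h3 : (3 : WithTop ℕ∞) ≠ 0 := by norm_num
  have hc : ContDiffAt ℝ 3 (lewisMap A q) l := (contDiff_lewisMap hA).contDiffAt
  have hd := (hasStrictFDerivAt_lewisMap hA hq l)
  exact ⟨hc.localInverse hd.hasFDerivAt h3, hc.to_localInverse hd.hasFDerivAt h3,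
    (hc.hasStrictFDerivAt' hd.hasFDerivAt h3).eventually_right_inverse⟩

/-! ### Lewis weights as global optimizers -/

section Value

variable {b : Fin m → ℝ} {x : Fin n → ℝ}

/-- `ℓ` solves the Lewis equation at the point `x`. -/
def IsLewis (q : ℝ) (A : Matrix (Fin m) (Fin n) ℝ) (b : Fin m → ℝ) (x : Fin n → ℝ)
    (l : Fin m → ℝ) : Prop :=
  ∀ i, lewisMap A q l i = -2 * Real.log ((A *ᵥ x) i - b i)

theorem exists_isLewis (hA : NonDegenerate A) (hq : 0 < q) (b : Fin m → ℝ) (x : Fin n → ℝ) :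
    ∃ l, IsLewis q A b x l := by
  obtain ⟨l, hl⟩ := lewisMap_surjective hA hq fun i => -2 * Real.log ((A *ᵥ x) i - b i)
  exact ⟨l, fun i => congrFun hl i⟩

theorem weightedGram_scaledMatrix (w : Fin m → ℝ) :
    weightedGram q (scaledMatrix A b x) w =
      Aᵀ * Matrix.diagonal (fun i => w i ^ (1 - 2 / q) * (((A *ᵥ x) i - b i)⁻¹) ^ 2) * A := by
  rw [weightedGram, scaledMatrix, Matrix.transpose_mul, Matrix.diagonal_transpose]
  have : ∀ D E : Matrix (Fin m) (Fin m) ℝ, Aᵀ * E * D * (E * A) = Aᵀ * (E * D * E) * A := by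
    intro D E; simp only [Matrix.mul_assoc]
  rw [this, Matrix.diagonal_mul_diagonal, Matrix.diagonal_mul_diagonal]
  congr 3
  funext i
  ring

theorem weightedGram_eq_expGram (hx : x ∈ interiorSet A b) {w : Fin m → ℝ} (hw : ∀ i, 0 < w i) :
    weightedGram q (scaledMatrix A b x) w =
      expGram A fun i => (1 - 2 / q) * Real.log (w i) - 2 * Real.log ((A *ᵥ x) i - b i) := by
  rw [weightedGram_scaledMatrix, expGram]
  congr 3
  funext i
  have hs : 0 < (A *ᵥ x) i - b i := sub_pos.mpr (hx i)
  rw [Real.exp_sub, Real.rpow_def_of_pos (hw i), mul_comm (Real.log _), two_mul (Real.log _),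
    Real.exp_add, Real.exp_log hs, inv_pow, ← div_eq_mul_inv, sq]

theorem potential_eq (hx : x ∈ interiorSet A b) {w : Fin m → ℝ} (hw : ∀ i, 0 < w i) :
    potential q A b x w =
      logDet A (fun i => (1 - 2 / q) * Real.log (w i) - 2 * Real.log ((A *ᵥ x) i - b i)) -
        (1 - 2 / q) * ∑ i, w i := by
  rw [potential, weightedGram_eq_expGram hx hw, logDet]

theorem mem_admissibleWeights (hA : NonDegenerate A) (hx : x ∈ interiorSet A b) {w : Fin m → ℝ}
    (hw : ∀ i, 0 < w i) : w ∈ admissibleWeights q A b x := by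
  refine ⟨fun i => (hw i).le, fun _ => hw, ?_⟩
  rw [weightedGram_eq_expGram hx hw]
  exact (expGram_posDef hA.injective _).det_pos

variable {l : Fin m → ℝ}

theorem IsLewis.eq (hl : IsLewis q A b x l) :
    l = fun i => (1 - 2 / q) * Real.log (lev A l i) - 2 * Real.log ((A *ᵥ x) i - b i) := by
  funext i
  have := hl i
  rw [lewisMap] at this
  linarith

/-- The barrier value in terms of a solution of the Lewis equation. -/
def lewisValue (q : ℝ) (A : Matrix (Fin m) (Fin n) ℝ) (l : Fin m → ℝ) : ℝ :=
  1 / 2 * (logDet A l - (1 - 2 / q) * n)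

theorem IsLewis.potential_lev (hA : NonDegenerate A) (hx : x ∈ interiorSet A b)
    (hl : IsLewis q A b x l) :
    potential q A b x (lev A l) = logDet A l - (1 - 2 / q) * n := by
  rw [potential_eq hx (lev_pos hA l), ← hl.eq, sum_lev hA.injective]

theorem IsLewis.lewisValue_mem (hA : NonDegenerate A) (hx : x ∈ interiorSet A b)
    (hl : IsLewis q A b x l) : lewisValue q A l ∈ barrierValues q A b x :=
  ⟨lev A l, mem_admissibleWeights hA hx (lev_pos hA l), by
    simp only [lewisValue, hl.potential_lev hA hx]⟩

theorem IsLewis.exp_eq (hA : NonDegenerate A) (hx : x ∈ interiorSet A b)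
    (hl : IsLewis q A b x l) (i : Fin m) :
    Real.exp (l i) = lev A l i ^ (1 - 2 / q) * (((A *ᵥ x) i - b i)⁻¹) ^ 2 := by
  have hs : 0 < (A *ᵥ x) i - b i := sub_pos.mpr (hx i)
  conv_lhs => rw [hl.eq]
  rw [Real.exp_sub, Real.rpow_def_of_pos (lev_pos hA l i), mul_comm (Real.log _),
    two_mul (Real.log _), Real.exp_add, Real.exp_log hs, inv_pow, ← div_eq_mul_inv, sq]

/-- `aᵢᵀ (Aᵀ diag(e^ℓ) A)⁻¹ aᵢ = wᵢ^(2/q) sᵢ²`. -/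
theorem IsLewis.hat_eq (hA : NonDegenerate A) (hx : x ∈ interiorSet A b)
    (hl : IsLewis q A b x l) (i : Fin m) :
    hat A l i i = lev A l i ^ (2 / q) * ((A *ᵥ x) i - b i) ^ 2 := by
  have hs : 0 < (A *ᵥ x) i - b i := sub_pos.mpr (hx i)
  have hσ := lev_pos hA l i
  have h1 : lev A l i = Real.exp (l i) * hat A l i i := rfl
  refine mul_left_cancel₀ (Real.exp_pos (l i)).ne' ?_
  rw [← h1, hl.exp_eq hA hx]
  have h2 : lev A l i ^ (1 - 2 / q) * lev A l i ^ (2 / q) = lev A l i := by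
    rw [← Real.rpow_add hσ]; simp
  calc lev A l i = (lev A l i ^ (1 - 2 / q) * lev A l i ^ (2 / q)) *
        (((A *ᵥ x) i - b i)⁻¹ * ((A *ᵥ x) i - b i)) ^ 2 := by
        rw [h2, inv_mul_cancel₀ hs.ne']; ring
    _ = _ := by ring

/-- The supporting plane of the concave log det at e^ℓ replaces log det by ∑ w_i^{1-2/q}
lev_i^{2/q}. For q ≥ 2 the exponents are nonnegative with sum 1, so AM-GM makes this linear in w. -/
theorem IsLewis.isGreatest (hA : NonDegenerate A) (hx : x ∈ interiorSet A b) (hq : 2 ≤ q)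
    (hl : IsLewis q A b x l) : IsGreatest (barrierValues q A b x) (lewisValue q A l) := by
  refine ⟨hl.lewisValue_mem hA hx, ?_⟩
  rintro _ ⟨w, ⟨hw0, -, hdet⟩, rfl⟩
  simp only [lewisValue]
  refine mul_le_mul_of_nonneg_left ?_ (by norm_num)
  have hp0 : 0 ≤ 1 - 2 / q := by
    rw [sub_nonneg, div_le_one (by linarith)]; exact hq
  have hp1 : 0 ≤ 2 / q := by positivity
  rw [potential]
  rw [weightedGram_scaledMatrix] at hdet ⊢
  have h := log_det_gram_le hA.injective l _
    (fun i => mul_nonneg (Real.rpow_nonneg (hw0 i) _) (sq_nonneg _)) hdet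
  have hterm : ∀ i, w i ^ (1 - 2 / q) * (((A *ᵥ x) i - b i)⁻¹) ^ 2 * hat A l i i ≤
      (1 - 2 / q) * w i + 2 / q * lev A l i := by
    intro i
    have hs : 0 < (A *ᵥ x) i - b i := sub_pos.mpr (hx i)
    have h1 := Real.geom_mean_le_arith_mean2_weighted hp0 hp1 (hw0 i) (lev_pos hA l i).le (by ring)
    refine le_trans (le_of_eq ?_) h1
    rw [hl.hat_eq hA hx i]
    calc _ = w i ^ (1 - 2 / q) * lev A l i ^ (2 / q) *
          (((A *ᵥ x) i - b i)⁻¹ * ((A *ᵥ x) i - b i)) ^ 2 := by ring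
      _ = _ := by rw [inv_mul_cancel₀ hs.ne']; ring
  have hsum := Finset.sum_le_sum fun i (_ : i ∈ Finset.univ) => hterm i
  rw [Finset.sum_add_distrib, ← Finset.mul_sum, ← Finset.mul_sum, sum_lev hA.injective] at hsum
  linarith

/-- Here 1 - 2/q ≤ 0, and the supporting plane of the function `logDet`, convex in ℓ, is used
instead. It leaves terms lev · log(w/lev), bounded by w - lev, and the nonpositive coefficient
reverses this bound. -/
theorem IsLewis.isLeast (hA : NonDegenerate A) (hx : x ∈ interiorSet A b) (hq0 : 0 < q)
    (hq : q ≤ 2) (hl : IsLewis q A b x l) :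
    IsLeast (barrierValues q A b x) (lewisValue q A l) := by
  refine ⟨hl.lewisValue_mem hA hx, ?_⟩
  rintro _ ⟨w, ⟨hw0, hw1, hdet⟩, rfl⟩
  simp only [lewisValue]
  refine mul_le_mul_of_nonneg_left ?_ (by norm_num)
  rcases hq.eq_or_lt with h2 | h2
  -- At q = 2 zero entries of w are admissible, so log w is unusable; the potential does not depend
  -- on w.
  · have hp : 1 - 2 / q = 0 := by rw [h2]; norm_num
    have h1 := hl.potential_lev hA hx
    simp only [potential, weightedGram, hp, Real.rpow_zero, zero_mul] at h1 ⊢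
    exact h1.symm.le
  have hw := hw1 h2
  have hp0 : 1 - 2 / q ≤ 0 := by
    rw [sub_nonpos, one_le_div hq0]; exact hq
  rw [potential_eq hx hw]
  have h := logDet_ge hA.injective l
    (fun i => (1 - 2 / q) * Real.log (w i) - 2 * Real.log ((A *ᵥ x) i - b i))
  have hterm : ∀ i, (1 - 2 / q) * (w i - lev A l i) ≤
      lev A l i * ((1 - 2 / q) * Real.log (w i) - 2 * Real.log ((A *ᵥ x) i - b i) - l i) := by
    intro i
    have hσ := lev_pos hA l i
    have h1 := Real.log_le_sub_one_of_pos (div_pos (hw i) hσ)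
    rw [Real.log_div (hw i).ne' hσ.ne'] at h1
    have h3 : lev A l i * (Real.log (w i) - Real.log (lev A l i)) ≤ w i - lev A l i := by
      calc _ ≤ lev A l i * (w i / lev A l i - 1) := mul_le_mul_of_nonneg_left h1 hσ.le
        _ = _ := by field_simp
    have h4 := mul_le_mul_of_nonpos_left h3 hp0
    have h5 : (1 - 2 / q) * Real.log (w i) - 2 * Real.log ((A *ᵥ x) i - b i) - l i =
        (1 - 2 / q) * (Real.log (w i) - Real.log (lev A l i)) := by
      have := hl i
      rw [lewisMap] at this
      linarith
    rw [h5]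
    linarith
  have hsum := Finset.sum_le_sum fun i (_ : i ∈ Finset.univ) => hterm i
  rw [← Finset.mul_sum, Finset.sum_sub_distrib, sum_lev hA.injective] at hsum
  linarith

theorem IsLewis.barrier_eq (hA : NonDegenerate A) (hx : x ∈ interiorSet A b) (hq : 0 < q)
    (hl : IsLewis q A b x l) : barrier q A b x = lewisValue q A l := by
  rw [barrier]
  split_ifs with h
  · exact (hl.isGreatest hA hx h).csSup_eq
  · exact (hl.isLeast hA hx hq (not_le.mp h).le).csInf_eq

end Value

end

/-! ### The algebraic identity behind the third derivative -/

section

variable {m n : ℕ} {A : Matrix (Fin m) (Fin n) ℝ} {q : ℝ}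

theorem isOpen_interiorSet (A : Matrix (Fin m) (Fin n) ℝ) (b : Fin m → ℝ) :
    IsOpen (interiorSet A b) := by
  have : interiorSet A b = ⋂ i, {x | b i < (A *ᵥ x) i} := by ext; simp [interiorSet]
  rw [this]
  refine isOpen_iInter_of_finite fun i => isOpen_lt continuous_const ?_
  exact (continuous_apply i).comp (Continuous.matrix_mulVec continuous_const continuous_id)

/-- F stands for the derivative of wρ and z' for that of z; the left side is the derivative of ∑w(y²
- ρy), using y' = -y². The identity removes z' without inverting a linear system. Writing y through
ρ and z, symmetry of R reduces the z' terms of ∑zF to ∑wρz', and the differentiated Lewis relation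
cancels these against ∑Fρ. -/
theorem LewisVelocity.third_eq (hA : Function.Injective A.mulVec)
    {l y z ρ : Fin m → ℝ} (hV : LewisVelocity A q l y z ρ) {F z' : Fin m → ℝ}
    (hF : ∀ i, F i = lev A l i * ρ i * z i + lev A l i * z' i -
      ∑ j, ((projSq A l i j * (z i + z j) - 2 * (Real.exp (l i) * Real.exp (l j) *
        hat A l i j * ∑ k, hat A l i k * (Real.exp (l k) * z k) * hat A l k j)) * z j +
        projSq A l i j * z' j))
    (hz' : ∀ i, lev A l i * z' i = (1 - 2 / q) * F i - (1 - 2 / q) * (lev A l i * ρ i ^ 2) +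
      2 * (lev A l i * y i ^ 2)) :
    ∑ i, lev A l i * (2 * (ρ i * y i ^ 2) - 2 * y i ^ 3) - ∑ i, F i * y i =
      third A q l y z ρ := by
  have hR : ∀ v : Fin m → ℝ, ∑ i, v i * ∑ j, projSq A l i j * z j =
      ∑ i, lev A l i * (v i * (z i - ρ i)) := fun v =>
    Finset.sum_congr rfl fun i _ => by rw [hV.sum_projSq_mul i]; ring
  have hR' : ∑ i, z i * ∑ j, projSq A l i j * z' j = ∑ i, lev A l i * (z' i * (z i - ρ i)) := by
    rw [← hR z']
    simp only [Finset.mul_sum]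
    rw [Finset.sum_comm]
    refine Finset.sum_congr rfl fun i _ => Finset.sum_congr rfl fun j _ => ?_
    rw [projSq_comm hA l j i]; ring
  have hR2 : ∑ i, z i * ∑ j, projSq A l i j * z j ^ 2 =
      ∑ i, lev A l i * (z i ^ 2 * (z i - ρ i)) := by
    rw [← hR fun i => z i ^ 2]
    simp only [Finset.mul_sum]
    rw [Finset.sum_comm]
    refine Finset.sum_congr rfl fun i _ => Finset.sum_congr rfl fun j _ => ?_
    rw [projSq_comm hA l j i]; ring
  -- The inner sum is made opaque so that distributing products over sums leaves it intact.
  obtain ⟨N, hN⟩ : ∃ N : Fin m → Fin m → ℝ, ∀ i j,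
      N i j = ∑ k, hat A l i k * (Real.exp (l k) * z k) * hat A l k j := ⟨_, fun _ _ => rfl⟩
  have hcube : projCube A l z = ∑ i, z i * ∑ j, Real.exp (l i) * Real.exp (l j) *
      hat A l i j * N i j * z j := by
    simp only [projCube, ← hN]
    refine Finset.sum_congr rfl fun i _ => ?_
    rw [Finset.mul_sum]
    exact Finset.sum_congr rfl fun j _ => by ring
  have hF' : ∀ i, F i = lev A l i * ρ i * z i + lev A l i * z' i - (z i * ∑ j, projSq A l i j * z j
      + ∑ j, projSq A l i j * z j ^ 2 - 2 * ∑ j, Real.exp (l i) * Real.exp (l j) *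
      hat A l i j * N i j * z j + ∑ j, projSq A l i j * z' j) := by
    intro i
    rw [hF i]
    simp only [← hN]
    congr 1
    simp only [Finset.mul_sum, ← Finset.sum_add_distrib, ← Finset.sum_sub_distrib]
    exact Finset.sum_congr rfl fun j _ => by ring
  have hzF : ∑ i, z i * F i = ∑ i, lev A l i * (ρ i * z i ^ 2) + ∑ i, lev A l i * (z i * z' i)
      - ∑ i, z i ^ 2 * ∑ j, projSq A l i j * z j - ∑ i, z i * ∑ j, projSq A l i j * z j ^ 2
      + 2 * projCube A l z - ∑ i, z i * ∑ j, projSq A l i j * z' j := by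
    rw [hcube, Finset.mul_sum]
    simp only [← Finset.sum_add_distrib, ← Finset.sum_sub_distrib]
    exact Finset.sum_congr rfl fun i _ => by rw [hF' i]; ring
  rw [hR', hR2, hR fun i => z i ^ 2] at hzF
  have hy : ∀ i, y i = ((1 - 2 / q) * ρ i - z i) / 2 := fun i => by
    have := hV.eq_sub i
    linarith
  have hFy : ∑ i, F i * y i = (1 - 2 / q) / 2 * ∑ i, F i * ρ i - 1 / 2 * ∑ i, z i * F i := by
    rw [Finset.mul_sum, Finset.mul_sum, ← Finset.sum_sub_distrib]
    exact Finset.sum_congr rfl fun i _ => by rw [hy i]; ring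
  rw [hFy, hzF, third]
  rw [← sub_eq_zero]
  have hsum : ∀ a c d e f g h : Fin m → ℝ, ∀ T : ℝ,
      ∑ i, a i - ((1 - 2 / q) / 2 * ∑ i, c i - 1 / 2 * (∑ i, d i + ∑ i, e i - ∑ i, f i - ∑ i, f i
        + 2 * T - ∑ i, g i)) - (∑ i, h i + T) =
      ∑ i, (a i - ((1 - 2 / q) / 2 * c i - 1 / 2 * (d i + e i - f i - f i - g i)) - h i) := by
    intro a c d e f g h T
    simp only [Finset.sum_sub_distrib, Finset.sum_add_distrib, ← Finset.mul_sum]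
    ring
  rw [hsum]
  refine Finset.sum_eq_zero fun i _ => ?_
  have e1 := hz' i
  have e2 : lev A l i * (z i * z' i) - lev A l i * (z' i * (z i - ρ i)) =
      ρ i * (lev A l i * z' i) := by ring
  have e3 := hy i
  have e4 : (1 - 2 / q) / 2 * (F i * ρ i) = 1 / 2 * (ρ i * (lev A l i * z' i) +
    (1 - 2 / q) * (lev A l i * ρ i ^ 3) - 2 * (lev A l i * (ρ i * y i ^ 2))) := by
    rw [e1]; ring
  rw [e4]
  ring

end

/-! ### Derivatives of the barrier along lines -/

section

variable {m n : ℕ} {A : Matrix (Fin m) (Fin n) ℝ} {q : ℝ} {b : Fin m → ℝ} {x h : Fin n → ℝ}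

/-- The derivative of `log (A x - b)` in the direction `h`. -/
def slackVelocity (A : Matrix (Fin m) (Fin n) ℝ) (b : Fin m → ℝ) (x h : Fin n → ℝ) (i : Fin m) : ℝ :=
  (A *ᵥ h) i / ((A *ᵥ x) i - b i)

/-- The derivative of `log (lev A ℓ)` in the direction `z`. -/
def weightVelocity (A : Matrix (Fin m) (Fin n) ℝ) (l z : Fin m → ℝ) (i : Fin m) : ℝ :=
  (lev A l i * z i - ∑ j, projSq A l i j * z j) / lev A l i

theorem lev_mul_weightVelocity (hA : NonDegenerate A) (l z : Fin m → ℝ) (i : Fin m) :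
    lev A l i * weightVelocity A l z i = lev A l i * z i - ∑ j, projSq A l i j * z j :=
  mul_div_cancel₀ _ (lev_pos hA l i).ne'

theorem hasDerivAt_slack (t : ℝ) (i : Fin m) :
    HasDerivAt (fun r : ℝ => (A *ᵥ (x + r • h)) i - b i) ((A *ᵥ h) i) t := by
  have e : (fun r : ℝ => (A *ᵥ (x + r • h)) i - b i) =
      fun r : ℝ => (A *ᵥ x) i - b i + r * (A *ᵥ h) i := by
    funext r
    rw [Matrix.mulVec_add, Matrix.mulVec_smul]
    simp only [Pi.add_apply, Pi.smul_apply, smul_eq_mul]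
    ring
  rw [e]
  simpa using ((hasDerivAt_id t).mul_const ((A *ᵥ h) i)).const_add ((A *ᵥ x) i - b i)

theorem hasDerivAt_slackVelocity {t : ℝ} (hx : x + t • h ∈ interiorSet A b) (i : Fin m) :
    HasDerivAt (fun r : ℝ => slackVelocity A b (x + r • h) h i)
      (-slackVelocity A b (x + t • h) h i ^ 2) t := by
  have hs : (A *ᵥ (x + t • h)) i - b i ≠ 0 := (sub_pos.mpr (hx i)).ne'
  have := (hasDerivAt_const t ((A *ᵥ h) i)).div (hasDerivAt_slack (x := x) (h := h) (b := b) t i) hs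
  refine this.congr_deriv ?_
  rw [slackVelocity]
  field_simp
  ring

section Line

variable {l z : ℝ → Fin m → ℝ} {t : ℝ}

theorem IsLewis.lewisVelocity (hA : NonDegenerate A) (hx : x + t • h ∈ interiorSet A b)
    (hl : ∀ᶠ r in 𝓝 t, IsLewis q A b (x + r • h) (l r)) (hd : HasDerivAt l (z t) t) :
    LewisVelocity A q (l t) (slackVelocity A b (x + t • h) h) (z t)
      (weightVelocity A (l t) (z t)) := by
  refine ⟨lev_mul_weightVelocity hA _ _, fun i => ?_⟩
  have hs : (A *ᵥ (x + t • h)) i - b i ≠ 0 := (sub_pos.mpr (hx i)).ne'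
  have h1 := hasDerivAt_lewisMap (q := q) hA hd i
  have h2 := ((hasDerivAt_slack (x := x) (h := h) (b := b) t i).log hs).const_mul (-2)
  have h3 := h1.unique (h2.congr_of_eventuallyEq (hl.mono fun r hr => hr i))
  rw [weightVelocity, slackVelocity]
  linarith

theorem hasDerivAt_lewisValue (hA : NonDegenerate A) (hx : x + t • h ∈ interiorSet A b)
    (hl : ∀ᶠ r in 𝓝 t, IsLewis q A b (x + r • h) (l r)) (hd : HasDerivAt l (z t) t) :
    HasDerivAt (fun r => lewisValue q A (l r))
      (-∑ i, lev A (l t) i * slackVelocity A b (x + t • h) h i) t := by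
  have hV := IsLewis.lewisVelocity hA hx hl hd
  refine (((hasDerivAt_logDet hA.injective hd).sub_const _).const_mul (1 / 2)).congr_deriv ?_
  -- The total weight is constant, so the motion of the weights contributes nothing to first order.
  have h0 : ∑ i, lev A (l t) i * weightVelocity A (l t) (z t) i = 0 := by
    calc _ = ∑ i, (lev A (l t) i * z t i - ∑ j, projSq A (l t) i j * z t j) :=
          Finset.sum_congr rfl fun i _ => hV.lev_mul i
      _ = 0 := by
        rw [Finset.sum_sub_distrib, Finset.sum_comm, sub_eq_zero]
        refine Finset.sum_congr rfl fun i _ => ?_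
        rw [← sum_projSq hA.injective, Finset.sum_mul]
        exact Finset.sum_congr rfl fun j _ => by rw [projSq_comm hA.injective]
  have h1 : ∑ i, lev A (l t) i * z t i = (1 - 2 / q) * ∑ i, lev A (l t) i *
      weightVelocity A (l t) (z t) i - 2 * ∑ i, lev A (l t) i * slackVelocity A b (x + t • h) h i := by
    rw [Finset.mul_sum, Finset.mul_sum, ← Finset.sum_sub_distrib]
    exact Finset.sum_congr rfl fun i _ => by rw [hV.eq_sub i]; ring
  rw [h1, h0]; ring

theorem hasDerivAt_first (hA : NonDegenerate A) (hx : x + t • h ∈ interiorSet A b)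
    (hd : HasDerivAt l (z t) t) :
    HasDerivAt (fun r => -∑ i, lev A (l r) i * slackVelocity A b (x + r • h) h i)
      (LewisVelocity.second A (l t) (slackVelocity A b (x + t • h) h)
        (weightVelocity A (l t) (z t))) t := by
  have h1 := (HasDerivAt.fun_sum (u := Finset.univ) fun i _ =>
    (hasDerivAt_lev hA.injective hd i).mul (hasDerivAt_slackVelocity hx i)).neg
  refine h1.congr_deriv ?_
  rw [LewisVelocity.second, ← Finset.sum_neg_distrib]
  refine Finset.sum_congr rfl fun i _ => ?_
  rw [← lev_mul_weightVelocity hA]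
  ring

theorem hasDerivAt_second (hA : NonDegenerate A) {z' : Fin m → ℝ}
    (hx : x + t • h ∈ interiorSet A b)
    (hl : ∀ᶠ r in 𝓝 t, IsLewis q A b (x + r • h) (l r)) (hd : ∀ᶠ r in 𝓝 t, HasDerivAt l (z r) r)
    (hz : HasDerivAt z z' t) :
    HasDerivAt (fun r => LewisVelocity.second A (l r) (slackVelocity A b (x + r • h) h)
        (weightVelocity A (l r) (z r)))
      (LewisVelocity.third A q (l t) (slackVelocity A b (x + t • h) h) (z t)
        (weightVelocity A (l t) (z t))) t := by
  have hdt : HasDerivAt l (z t) t := hd.self_of_nhds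
  have hinj := hA.injective
  have hV := IsLewis.lewisVelocity hA hx hl hdt
  have hx' : ∀ᶠ r in 𝓝 t, x + r • h ∈ interiorSet A b := by
    have hc : ContinuousAt (fun r : ℝ => x + r • h) t := by fun_prop
    exact hc.eventually_mem ((isOpen_interiorSet A b).mem_nhds hx)
  set y := slackVelocity A b (x + t • h) h with hy
  set ρ := weightVelocity A (l t) (z t) with hρ
  have hzi := hasDerivAt_pi.mp hz
  obtain ⟨F, hF⟩ : ∃ F : Fin m → ℝ, ∀ i, F i = lev A (l t) i * ρ i * z t i + lev A (l t) i * z' i -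
      ∑ j, ((projSq A (l t) i j * (z t i + z t j) - 2 * (Real.exp (l t i) * Real.exp (l t j) *
        hat A (l t) i j *
          ∑ k, hat A (l t) i k * (Real.exp (l t k) * z t k) * hat A (l t) k j)) * z t j +
        projSq A (l t) i j * z' j) := ⟨_, fun _ => rfl⟩
  have hFd : ∀ i, HasDerivAt (fun r => lev A (l r) i * z r i - ∑ j, projSq A (l r) i j * z r j)
      (F i) t := by
    intro i
    have h1 := ((hasDerivAt_lev hinj hdt i).mul (hzi i)).sub
      (HasDerivAt.fun_sum (u := Finset.univ) fun j _ => (hasDerivAt_projSq hinj hdt i j).mul (hzi j))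
    refine h1.congr_deriv ?_
    rw [hF i, ← hV.lev_mul i]
  have hρd : ∀ i, HasDerivAt (fun r => weightVelocity A (l r) (z r) i)
      (F i / lev A (l t) i - ρ i ^ 2) t := by
    intro i
    have hσ := (lev_pos hA (l t) i).ne'
    have h1 := (hFd i).div (hasDerivAt_lev hinj hdt i) hσ
    refine h1.congr_deriv ?_
    rw [← hV.lev_mul i]
    field_simp
  have hz' : ∀ i, lev A (l t) i * z' i = (1 - 2 / q) * F i -
      (1 - 2 / q) * (lev A (l t) i * ρ i ^ 2) + 2 * (lev A (l t) i * y i ^ 2) := by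
    intro i
    have hσ := (lev_pos hA (l t) i).ne'
    -- The linear relation for z holds near t, not only at t, so it may be differentiated to obtain
    -- z'.
    have hev : (fun r => z r i) =ᶠ[𝓝 t] fun r => (1 - 2 / q) * weightVelocity A (l r) (z r) i -
        2 * slackVelocity A b (x + r • h) h i := by
      filter_upwards [hl.eventually_nhds, hd, hx'] with r h1 h2 h3
      exact (IsLewis.lewisVelocity hA h3 h1 h2).eq_sub i
    have h1 := (((hρd i).const_mul (1 - 2 / q)).sub
      ((hasDerivAt_slackVelocity hx i).const_mul 2)).congr_of_eventuallyEq hev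
    rw [(hzi i).unique h1]
    field_simp
    ring
  rw [← hV.third_eq hinj hF hz']
  have e : (fun r => LewisVelocity.second A (l r) (slackVelocity A b (x + r • h) h)
        (weightVelocity A (l r) (z r))) = fun r => ∑ i,
      (lev A (l r) i * slackVelocity A b (x + r • h) h i ^ 2 -
        (lev A (l r) i * z r i - ∑ j, projSq A (l r) i j * z r j) *
          slackVelocity A b (x + r • h) h i) := by
    funext r
    refine Finset.sum_congr rfl fun i _ => ?_
    rw [← lev_mul_weightVelocity hA]; ring
  rw [e]
  have h1 := HasDerivAt.fun_sum (u := Finset.univ) fun i _ =>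
    ((hasDerivAt_lev hinj hdt i).mul ((hasDerivAt_slackVelocity hx i).pow 2)).sub
      ((hFd i).mul (hasDerivAt_slackVelocity hx i))
  refine h1.congr_deriv ?_
  rw [← Finset.sum_sub_distrib]
  refine Finset.sum_congr rfl fun i _ => ?_
  simp only [Pi.pow_apply]
  rw [← hV.lev_mul i, ← hy]
  push_cast
  ring

end Line

/-- A local inverse of `lewisMap` composed with x ↦ -2 log(Ax - b). No uniqueness of Lewis solutions
is needed, since any solution yields the barrier value. -/
theorem exists_local_isLewis (hA : NonDegenerate A) (hq : 0 < q) (hx : x ∈ interiorSet A b) :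
    ∃ L : (Fin n → ℝ) → Fin m → ℝ, ContDiffAt ℝ 3 L x ∧
      ∀ᶠ x' in 𝓝 x, IsLewis q A b x' (L x') := by
  obtain ⟨l, hl⟩ := exists_isLewis hA hq b x
  obtain ⟨g, hg, hgr⟩ := exists_local_inverse_lewisMap hA hq l
  set S : (Fin n → ℝ) → Fin m → ℝ := fun x i => -2 * Real.log ((A *ᵥ x) i - b i) with hS
  have hSx : lewisMap A q l = S x := funext hl
  rw [hSx] at hg hgr
  have hSd : ContDiffAt ℝ 3 S x := by
    rw [contDiffAt_pi]
    intro i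
    refine contDiffAt_const.mul (ContDiffAt.log ?_ (sub_pos.mpr (hx i)).ne')
    simp only [Matrix.mulVec, dotProduct]
    fun_prop
  exact ⟨g ∘ S, hg.comp x hSd, (hSd.continuousAt.eventually hgr).mono fun x' h i => congrFun h i⟩

theorem contDiffAt_barrier (hA : NonDegenerate A) (hq : 0 < q) (hx : x ∈ interiorSet A b) :
    ContDiffAt ℝ 3 (barrier q A b) x := by
  obtain ⟨L, hL, hev⟩ := exists_local_isLewis hA hq hx
  have h1 : barrier q A b =ᶠ[𝓝 x] fun x' => lewisValue q A (L x') := by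
    filter_upwards [hev, (isOpen_interiorSet A b).mem_nhds hx] with x' h1 h2
    exact h1.barrier_eq hA h2 hq
  refine ContDiffAt.congr_of_eventuallyEq ?_ h1
  exact contDiffAt_const.mul
    (((contDiff_logDet hA.injective).contDiffAt.comp x hL).sub contDiffAt_const)

theorem hasDerivAt_iteratedFDeriv_line {E : Type*} [NormedAddCommGroup E] [NormedSpace ℝ E]
    {f : E → ℝ} {x h : E} {t : ℝ} {k : ℕ} (hf : ContDiffAt ℝ (k + 1) f (x + t • h)) :
    HasDerivAt (fun r : ℝ => iteratedFDeriv ℝ k f (x + r • h) fun _ => h)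
      (iteratedFDeriv ℝ (k + 1) f (x + t • h) fun _ => h) t := by
  have hd : DifferentiableAt ℝ (iteratedFDeriv ℝ k f) (x + t • h) :=
    hf.differentiableAt_iteratedFDeriv (by norm_cast; exact lt_add_one k)
  have hline : HasDerivAt (fun r : ℝ => x + r • h) h t :=
    (((hasDerivAt_id t).smul_const h).const_add x).congr_deriv (one_smul _ _)
  have h1 : DifferentiableAt ℝ (fun r : ℝ => iteratedFDeriv ℝ k f (x + r • h) fun _ => h) t :=
    (hd.comp t hline.differentiableAt).continuousMultilinear_apply_const _
  rw [← hf.deriv_fderiv_add_smul]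
  exact h1.hasDerivAt

/-- The derivatives of the barrier in the direction `h`. -/
theorem barrier_derivatives (hA : NonDegenerate A) (hq : 0 < q) (hx : x ∈ interiorSet A b)
    (h : Fin n → ℝ) :
    ∃ l z ρ : Fin m → ℝ, IsLewis q A b x l ∧
      LewisVelocity A q l (slackVelocity A b x h) z ρ ∧
      fderiv ℝ (barrier q A b) x h = -∑ i, lev A l i * slackVelocity A b x h i ∧
      iteratedFDeriv ℝ 2 (barrier q A b) x ![h, h] =
        LewisVelocity.second A l (slackVelocity A b x h) ρ ∧
      iteratedFDeriv ℝ 3 (barrier q A b) x ![h, h, h] =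
        LewisVelocity.third A q l (slackVelocity A b x h) z ρ := by
  obtain ⟨L, hL, hev⟩ := exists_local_isLewis hA hq hx
  set ψ := barrier q A b with hψ
  set c : ℝ → Fin n → ℝ := fun r => x + r • h with hc
  have hc0 : c 0 = x := by simp [hc]
  have hcc : ContDiff ℝ 3 c := by rw [hc]; fun_prop
  have hct : Tendsto c (𝓝 0) (𝓝 x) := by
    have := hcc.continuous.tendsto 0
    rwa [hc0] at this
  set l : ℝ → Fin m → ℝ := fun r => L (c r) with hl
  have hld : ContDiffAt ℝ 3 l 0 := by
    have hL' : ContDiffAt ℝ 3 L (c 0) := by rwa [hc0]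
    exact hL'.comp (0 : ℝ) hcc.contDiffAt
  have hd : ∀ᶠ r in 𝓝 (0 : ℝ), HasDerivAt l (deriv l r) r := by
    filter_upwards [hld.eventually (by simp)] with r hr
    exact (hr.differentiableAt (by norm_num)).hasDerivAt
  have hz : HasDerivAt (deriv l) (deriv (deriv l) 0) 0 := by
    have h1 : ContDiffAt ℝ 1 (fderiv ℝ l) 0 := hld.fderiv_right (by norm_num)
    have h2 : DifferentiableAt ℝ (deriv l) 0 := by
      have : deriv l = fun r => fderiv ℝ l r 1 := by funext r; rw [fderiv_apply_one_eq_deriv]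
      rw [this]
      exact (h1.differentiableAt one_ne_zero).clm_apply (differentiableAt_const _)
    exact h2.hasDerivAt
  have hlew : ∀ᶠ r in 𝓝 (0 : ℝ), IsLewis q A b (c r) (l r) := hct.eventually hev
  have hint : ∀ᶠ r in 𝓝 (0 : ℝ), c r ∈ interiorSet A b :=
    hct.eventually ((isOpen_interiorSet A b).mem_nhds hx)
  have hx0 : x + (0 : ℝ) • h ∈ interiorSet A b := by simpa using hx
  have hcd : ∀ᶠ r in 𝓝 (0 : ℝ), ContDiffAt ℝ 3 ψ (c r) :=
    hint.mono fun r hr => contDiffAt_barrier hA hq hr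
  have hbar : ∀ᶠ r in 𝓝 (0 : ℝ), ψ (c r) = lewisValue q A (l r) := by
    filter_upwards [hint, hlew] with r h1 h2
    exact h2.barrier_eq hA h1 hq
  -- The formulas for the first and second derivatives are proved on a neighbourhood of 0, so that
  -- each can be differentiated again.
  have d1 : ∀ᶠ r in 𝓝 (0 : ℝ), (iteratedFDeriv ℝ 1 ψ (c r) fun _ => h) =
      -∑ i, lev A (l r) i * slackVelocity A b (c r) h i := by
    filter_upwards [hint, hlew.eventually_nhds, hd, hcd, hbar.eventually_nhds]
      with r h1 h2 h3 h4 h5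
    have e1 := hasDerivAt_iteratedFDeriv_line (k := 0) (h4.of_le (by norm_num))
    have e2 := hasDerivAt_lewisValue (z := deriv l) hA h1 h2 h3
    simp only [iteratedFDeriv_zero_apply] at e1
    exact e1.unique (e2.congr_of_eventuallyEq h5)
  have d2 : ∀ᶠ r in 𝓝 (0 : ℝ), (iteratedFDeriv ℝ 2 ψ (c r) fun _ => h) =
      LewisVelocity.second A (l r) (slackVelocity A b (c r) h)
        (weightVelocity A (l r) (deriv l r)) := by
    filter_upwards [hint, hd, hcd, d1.eventually_nhds] with r h1 h3 h4 h5
    have e1 := hasDerivAt_iteratedFDeriv_line (k := 1) (h4.of_le (by norm_num))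
    have e2 := hasDerivAt_first (z := deriv l) hA h1 h3
    exact e1.unique (e2.congr_of_eventuallyEq h5)
  have d3 : (iteratedFDeriv ℝ 3 ψ (c 0) fun _ => h) =
      LewisVelocity.third A q (l 0) (slackVelocity A b (c 0) h) (deriv l 0)
        (weightVelocity A (l 0) (deriv l 0)) := by
    have e1 := hasDerivAt_iteratedFDeriv_line (k := 2) (hcd.self_of_nhds.of_le (by norm_num))
    have e2 := hasDerivAt_second (z := deriv l) hA hx0 hlew hd hz
    exact e1.unique (e2.congr_of_eventuallyEq d2)
  have hV := IsLewis.lewisVelocity (z := deriv l) hA hx0 hlew hd.self_of_nhds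
  have hl0 := hlew.self_of_nhds
  have d1' := d1.self_of_nhds
  have d2' := d2.self_of_nhds
  have v2 : (![h, h] : Fin 2 → Fin n → ℝ) = fun _ => h := by
    funext i; fin_cases i <;> rfl
  have v3 : (![h, h, h] : Fin 3 → Fin n → ℝ) = fun _ => h := by
    funext i; fin_cases i <;> rfl
  change LewisVelocity A q (l 0) (slackVelocity A b (c 0) h) _ _ at hV
  rw [hc0] at hV hl0 d1' d2' d3
  rw [iteratedFDeriv_one_apply] at d1'
  rw [v3, v2]
  exact ⟨l 0, deriv l 0, weightVelocity A (l 0) (deriv l 0), hl0, hV, d1', d2', d3⟩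

end

/-! ### Barrier estimates, blow-up at the boundary and self-concordance -/

section

variable {m n : ℕ} {A : Matrix (Fin m) (Fin n) ℝ} {q : ℝ} {b : Fin m → ℝ} {x : Fin n → ℝ}

/-- The Lewis equation turns `mulVec_sq_le` into the hypothesis of `sq_le_rpow_mul_sum`: both e^ℓ
and Q_ii become powers of the weights times powers of the slacks. -/
theorem IsLewis.abs_slackVelocity_le (hA : NonDegenerate A) (hq : 0 < q)
    (hx : x ∈ interiorSet A b) {l : Fin m → ℝ} (hl : IsLewis q A b x l) (h : Fin n → ℝ)
    (i : Fin m) :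
    |slackVelocity A b x h i| ≤
      (m : ℝ) ^ (1 / (q + 2)) * √(∑ j, lev A l j * slackVelocity A b x h j ^ 2) := by
  set y := slackVelocity A b x h with hy
  have hs : ∀ j, 0 < (A *ᵥ x) j - b j := fun j => sub_pos.mpr (hx j)
  have hyi : ∀ j, y j = (A *ᵥ h) j / ((A *ᵥ x) j - b j) := fun j => rfl
  have key : ∀ i, y i ^ 2 ≤ lev A l i ^ (2 / q) * ∑ j, lev A l j ^ (1 - 2 / q) * y j ^ 2 := by
    intro i
    have h1 := mulVec_sq_le hA.injective l h i
    have h2 : ∑ j, Real.exp (l j) * (A *ᵥ h) j ^ 2 = ∑ j, lev A l j ^ (1 - 2 / q) * y j ^ 2 := by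
      refine Finset.sum_congr rfl fun j _ => ?_
      rw [hl.exp_eq hA hx j, hyi j, div_eq_mul_inv]; ring
    rw [h2, hl.hat_eq hA hx i] at h1
    rw [hyi i, div_pow, div_le_iff₀ (pow_pos (hs i) 2)]
    calc _ ≤ _ := h1
      _ = _ := by ring
  have h3 := sq_le_rpow_mul_sum hq (lev_pos hA l) key i
  have h4 : (m : ℝ) ^ (2 / (q + 2)) = ((m : ℝ) ^ (1 / (q + 2))) ^ 2 := by
    rw [← Real.rpow_natCast, ← Real.rpow_mul (Nat.cast_nonneg m)]
    congr 1
    push_cast; ring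
  have h5 : 0 ≤ (m : ℝ) ^ (1 / (q + 2)) := by positivity
  refine abs_le_of_sq_le_sq ?_ (by positivity)
  rw [mul_pow, Real.sq_sqrt (LewisVelocity.sum_sq_nonneg hA l y), ← h4]
  exact h3

theorem concordanceConst_pos (hq : 0 < q) : 0 < concordanceConst q m := by
  rw [concordanceConst]
  have : 0 < max q 2 := lt_max_of_lt_left hq
  positivity

theorem abs_third_barrier_le (hA : NonDegenerate A) (hq : 0 < q) (hx : x ∈ interiorSet A b)
    (h : Fin n → ℝ) :
    |iteratedFDeriv ℝ 3 (barrier q A b) x ![h, h, h]| ≤ 2 * concordanceConst q m *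
      √(iteratedFDeriv ℝ 2 (barrier q A b) x ![h, h]) ^ 3 := by
  obtain ⟨l, z, ρ, hl, hV, -, h2, h3⟩ := barrier_derivatives hA hq hx h
  rw [h2, h3]
  exact hV.abs_third_le hA hq (by positivity) (hl.abs_slackVelocity_le hA hq hx h)

theorem second_barrier_pos (hA : NonDegenerate A) (hq : 0 < q) (hx : x ∈ interiorSet A b)
    {h : Fin n → ℝ} (hh : h ≠ 0) : 0 < iteratedFDeriv ℝ 2 (barrier q A b) x ![h, h] := by
  obtain ⟨l, z, ρ, hl, hV, -, h2, -⟩ := barrier_derivatives hA hq hx h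
  rw [h2]
  refine lt_of_lt_of_le ?_ (hV.sum_y_sq_le hA hq)
  have hAh : A *ᵥ h ≠ 0 := fun h0 => hh (hA.injective (h0.trans (Matrix.mulVec_zero A).symm))
  obtain ⟨i, hi⟩ := Function.ne_iff.mp hAh
  refine Finset.sum_pos' (fun j _ => mul_nonneg (lev_pos hA l j).le (sq_nonneg _))
    ⟨i, Finset.mem_univ i, mul_pos (lev_pos hA l i) (sq_pos_iff.mpr ?_)⟩
  exact div_ne_zero hi (sub_pos.mpr (hx i)).ne'

theorem second_barrier_nonneg (hA : NonDegenerate A) (hq : 0 < q) (hx : x ∈ interiorSet A b)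
    (h : Fin n → ℝ) : 0 ≤ iteratedFDeriv ℝ 2 (barrier q A b) x ![h, h] := by
  obtain ⟨l, z, ρ, hl, hV, -, h2, -⟩ := barrier_derivatives hA hq hx h
  rw [h2]
  exact (LewisVelocity.sum_sq_nonneg hA l _).trans (hV.sum_y_sq_le hA hq)

/-- Cauchy-Schwarz with weights of total mass n, followed by ∑wy² ≤ ψ''. -/
theorem first_barrier_sq_le (hA : NonDegenerate A) (hq : 0 < q) (hx : x ∈ interiorSet A b)
    (h : Fin n → ℝ) :
    fderiv ℝ (barrier q A b) x h ^ 2 ≤ n * iteratedFDeriv ℝ 2 (barrier q A b) x ![h, h] := by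
  obtain ⟨l, z, ρ, hl, hV, h1, h2, -⟩ := barrier_derivatives hA hq hx h
  rw [h1, h2, neg_sq]
  refine le_trans ?_ (mul_le_mul_of_nonneg_left (hV.sum_y_sq_le hA hq) (Nat.cast_nonneg n))
  rw [← sum_lev hA.injective l]
  apply Finset.sum_sq_le_sum_mul_sum_of_sq_le_mul
  · exact fun i _ => (lev_pos hA l i).le
  · exact fun i _ => mul_nonneg (lev_pos hA l i).le (sq_nonneg _)
  · intro i _
    apply le_of_eq; ring

theorem iteratedFDeriv_two_eq_dotProduct (φ : (Fin n → ℝ) → ℝ) (x h : Fin n → ℝ) :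
    iteratedFDeriv ℝ 2 φ x ![h, h] = h ⬝ᵥ (hess φ x *ᵥ h) := by
  have hh : h = ∑ i, h i • (Pi.single i 1 : Fin n → ℝ) := by
    funext j; simp [Finset.sum_apply, Pi.single_apply]
  rw [iteratedFDeriv_two_apply]
  simp only [Matrix.cons_val_zero, Matrix.cons_val_one]
  conv_lhs => rw [hh]
  simp only [map_sum, map_smul, sum_apply, smul_apply,
    smul_eq_mul, dotProduct, Matrix.mulVec, hess, Matrix.of_apply, iteratedFDeriv_two_apply,
    Matrix.cons_val_zero, Matrix.cons_val_one, Finset.mul_sum]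
  rw [Finset.sum_comm]
  exact Finset.sum_congr rfl fun i _ => Finset.sum_congr rfl fun j _ => by ring

theorem fderiv_eq_dotProduct (φ : (Fin n → ℝ) → ℝ) (x h : Fin n → ℝ) :
    fderiv ℝ φ x h = grad φ x ⬝ᵥ h := by
  have hh : h = ∑ i, h i • (Pi.single i 1 : Fin n → ℝ) := by
    funext j; simp [Finset.sum_apply, Pi.single_apply]
  conv_lhs => rw [hh]
  simp only [map_sum, map_smul, smul_eq_mul, dotProduct, grad]
  exact Finset.sum_congr rfl fun i _ => mul_comm _ _

theorem hess_barrier_posDef (hA : NonDegenerate A) (hq : 0 < q) (hx : x ∈ interiorSet A b) :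
    (hess (barrier q A b) x).PosDef := by
  refine Matrix.PosDef.of_dotProduct_mulVec_pos ?_ fun h hh => ?_
  · refine Matrix.IsHermitian.ext fun i j => ?_
    have hs := (contDiffAt_barrier hA hq hx).isSymmSndFDerivAt (by simp; norm_num)
    simp only [hess, Matrix.of_apply, iteratedFDeriv_two_apply, Matrix.cons_val_zero,
      Matrix.cons_val_one, star_trivial]
    exact hs _ _
  · rw [star_trivial, ← iteratedFDeriv_two_eq_dotProduct]
    exact second_barrier_pos hA hq hx hh

/-- For h = B⁻¹g the first-derivative bound reads τ² ≤ nτ with τ = gᵀB⁻¹g, hence τ ≤ n. -/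
theorem grad_hess_inv_grad_le (hA : NonDegenerate A) (hq : 0 < q) (hx : x ∈ interiorSet A b) :
    grad (barrier q A b) x ⬝ᵥ ((hess (barrier q A b) x)⁻¹ *ᵥ grad (barrier q A b) x) ≤ n := by
  set g := grad (barrier q A b) x with hg
  set B := hess (barrier q A b) x with hB
  have hpos := hess_barrier_posDef hA hq hx
  have h1 := first_barrier_sq_le hA hq hx (B⁻¹ *ᵥ g)
  rw [fderiv_eq_dotProduct, iteratedFDeriv_two_eq_dotProduct, ← hg, ← hB, Matrix.mulVec_mulVec,
    Matrix.mul_nonsing_inv _ hpos.det_pos.ne'.isUnit, Matrix.one_mulVec,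
    dotProduct_comm _ g] at h1
  by_contra hlt
  push Not at hlt
  have hn : (0 : ℝ) ≤ n := Nat.cast_nonneg n
  nlinarith

theorem convex_interiorSet (A : Matrix (Fin m) (Fin n) ℝ) (b : Fin m → ℝ) :
    Convex ℝ (interiorSet A b) := by
  intro x hx y hy s t hs ht hst i
  rw [Matrix.mulVec_add, Matrix.mulVec_smul, Matrix.mulVec_smul]
  simp only [Pi.add_apply, Pi.smul_apply, smul_eq_mul]
  have h1 := hx i
  have h2 := hy i
  calc b i = s * b i + t * b i := by rw [← add_mul, hst, one_mul]
    _ < s * (A *ᵥ x) i + t * (A *ᵥ y) i := by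
      rcases hs.eq_or_lt with h0 | h0
      · have : t = 1 := by linarith
        rw [← h0, this]; linarith
      · exact add_lt_add_of_lt_of_le (mul_lt_mul_of_pos_left h1 h0)
          (mul_le_mul_of_nonneg_left h2.le ht)

/-- A `C²` function on an open convex set with positive semidefinite second derivative is convex. -/
theorem convexOn_of_iteratedFDeriv_two_nonneg {E : Type*} [NormedAddCommGroup E] [NormedSpace ℝ E]
    {K : Set E} {f : E → ℝ} (hK : Convex ℝ K) (hf : ∀ x ∈ K, ContDiffAt ℝ 2 f x)
    (h2 : ∀ x ∈ K, ∀ h, 0 ≤ iteratedFDeriv ℝ 2 f x fun _ => h) : ConvexOn ℝ K f := by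
  refine ⟨hK, fun x hx y hy s t hs ht hst => ?_⟩
  set h := y - x with hh
  have hmem : ∀ r ∈ Set.Icc (0 : ℝ) 1, x + r • h ∈ K := by
    intro r hr
    have := hK hx hy (sub_nonneg.mpr hr.2) hr.1 (by ring)
    convert! this using 1
    rw [hh]; module
  have d0 : ∀ r ∈ Set.Icc (0 : ℝ) 1, HasDerivAt (fun r : ℝ => f (x + r • h))
      (iteratedFDeriv ℝ 1 f (x + r • h) fun _ => h) r := by
    intro r hr
    have := hasDerivAt_iteratedFDeriv_line (k := 0) ((hf _ (hmem r hr)).of_le (by norm_num))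
    simpa only [iteratedFDeriv_zero_apply] using this
  have d1 : ∀ r ∈ Set.Icc (0 : ℝ) 1,
      HasDerivAt (fun r : ℝ => iteratedFDeriv ℝ 1 f (x + r • h) fun _ => h)
      (iteratedFDeriv ℝ 2 f (x + r • h) fun _ => h) r := fun r hr =>
    hasDerivAt_iteratedFDeriv_line (k := 1) ((hf _ (hmem r hr)).of_le (by norm_num))
  have hc : ConvexOn ℝ (Set.Icc (0 : ℝ) 1) fun r : ℝ => f (x + r • h) :=
    convexOn_of_hasDerivWithinAt2_nonneg (convex_Icc 0 1)
      (fun r hr => (d0 r hr).continuousAt.continuousWithinAt)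
      (fun r hr => (d0 r (interior_subset hr)).hasDerivWithinAt)
      (fun r hr => (d1 r (interior_subset hr)).hasDerivWithinAt)
      (fun r hr => h2 _ (hmem r (interior_subset hr)) h)
  have h3 := hc.2 (Set.left_mem_Icc.mpr zero_le_one) (Set.right_mem_Icc.mpr zero_le_one) hs ht hst
  simp only [smul_eq_mul, mul_zero, mul_one, zero_add, zero_smul, add_zero, one_smul] at h3
  have e1 : x + h = y := by rw [hh]; abel
  have e2 : x + t • h = s • x + t • y := by
    rw [hh, eq_sub_of_add_eq hst]; module
  rw [e1, e2] at h3
  exact h3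

/-- A lower bound with coefficients independent of x, from the supporting plane of `logDet` at ℓ =
0. For q ≥ 2 the test weight w = 1 suffices; for q ≤ 2 the Lewis solution satisfies ℓ ≥ -2 log s
because log lev ≤ 0. -/
theorem barrier_ge (hA : NonDegenerate A) (hq : 0 < q) (hx : x ∈ interiorSet A b) :
    1 / 2 * (logDet A 0 - |1 - 2 / q| * m) - ∑ i, lev A 0 i * Real.log ((A *ᵥ x) i - b i) ≤
      barrier q A b x := by
  obtain ⟨l, hl⟩ := exists_isLewis hA hq b x
  rw [hl.barrier_eq hA hx hq]
  rcases le_total 2 q with h | h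
  · have hp0 : 0 ≤ 1 - 2 / q := by
      rw [sub_nonneg, div_le_one (by linarith)]; exact h
    have h1 := (hl.isGreatest hA hx h).2
      ⟨fun _ => 1, mem_admissibleWeights hA hx (fun _ => one_pos), rfl⟩
    refine le_trans ?_ h1
    simp only [potential_eq hx (fun _ => one_pos)]
    have h2 := logDet_ge hA.injective 0 fun i => (1 - 2 / q) * Real.log 1 -
      2 * Real.log ((A *ᵥ x) i - b i)
    have h3 : ∑ i, lev A 0 i * ((1 - 2 / q) * Real.log 1 - 2 * Real.log ((A *ᵥ x) i - b i)
        - (0 : Fin m → ℝ) i) = -2 * ∑ i, lev A 0 i * Real.log ((A *ᵥ x) i - b i) := by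
      rw [Finset.mul_sum]
      exact Finset.sum_congr rfl fun i _ => by rw [Real.log_one, Pi.zero_apply]; ring
    rw [h3] at h2
    rw [abs_of_nonneg hp0]
    simp only [Finset.sum_const, Finset.card_univ, Fintype.card_fin, nsmul_eq_mul, mul_one]
    linarith
  · have hp0 : 1 - 2 / q ≤ 0 := by
      rw [sub_nonpos, one_le_div hq]; exact h
    have h2 := logDet_ge hA.injective 0 l
    have h3 : -2 * ∑ i, lev A 0 i * Real.log ((A *ᵥ x) i - b i) ≤
        ∑ i, lev A 0 i * (l i - (0 : Fin m → ℝ) i) := by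
      rw [Finset.mul_sum]
      refine Finset.sum_le_sum fun i _ => ?_
      have h4 := mul_nonneg_of_nonpos_of_nonpos hp0
        (Real.log_nonpos (lev_pos hA l i).le (lev_le_one hA l i))
      have h5 := hl i
      rw [lewisMap] at h5
      have h6 : -2 * Real.log ((A *ᵥ x) i - b i) ≤ l i := by linarith
      have h7 := mul_le_mul_of_nonneg_left h6 (lev_pos hA 0 i).le
      rw [Pi.zero_apply, sub_zero]
      linarith
    rw [lewisValue]
    have h8 : (1 - 2 / q) * n ≤ |1 - 2 / q| * m := by
      have : (1 - 2 / q) * n ≤ 0 := mul_nonpos_of_nonpos_of_nonneg hp0 (Nat.cast_nonneg n)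
      exact this.trans (by positivity)
    linarith

theorem blowsUp_barrier (hA : NonDegenerate A) (hq : 0 < q) :
    BlowsUpAtBoundary (interiorSet A b) (barrier q A b) := by
  intro u hu p hp hup
  have hslack : ∀ i, Tendsto (fun k => (A *ᵥ u k) i - b i) atTop (𝓝 ((A *ᵥ p) i - b i)) := by
    intro i
    have hc : Continuous fun x : Fin n → ℝ => (A *ᵥ x) i - b i :=
      ((continuous_apply i).comp (Continuous.matrix_mulVec continuous_const continuous_id)).sub
        continuous_const
    exact (hc.tendsto p).comp hup
  have hpos : ∀ k i, 0 < (A *ᵥ u k) i - b i := fun k i => sub_pos.mpr (hu k i)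
  have hnotmem : p ∉ interiorSet A b := by
    rw [(isOpen_interiorSet A b).frontier_eq] at hp
    exact hp.2
  obtain ⟨i₀, hi₀⟩ : ∃ i, (A *ᵥ p) i ≤ b i := by
    by_contra hcon
    push Not at hcon
    exact hnotmem hcon
  -- Some slack tends to 0, and its coefficient `lev A 0 i₀` is positive; the other slacks converge,
  -- so their -log terms stay bounded below.
  have hi₀' : (A *ᵥ p) i₀ - b i₀ = 0 :=
    le_antisymm (by linarith) (ge_of_tendsto' (hslack i₀) fun k => (hpos k i₀).le)
  have hzero : Tendsto (fun k => -Real.log ((A *ᵥ u k) i₀ - b i₀)) atTop atTop := by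
    refine tendsto_neg_atBot_atTop.comp (Real.tendsto_log_nhdsGT_zero.comp ?_)
    refine tendsto_nhdsWithin_iff.mpr ⟨?_, Eventually.of_forall fun k => hpos k i₀⟩
    rw [← hi₀']
    exact hslack i₀
  have hlow : ∀ i, ∃ c : ℝ, ∀ᶠ k in atTop, c ≤ -Real.log ((A *ᵥ u k) i - b i) := by
    intro i
    refine ⟨-((A *ᵥ p) i - b i + 1), ?_⟩
    filter_upwards [(hslack i).eventually_le_const (lt_add_one _)] with k hk
    have := Real.log_le_sub_one_of_pos (hpos k i)
    linarith
  choose c hc using hlow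
  have hsum : Tendsto (fun k => lev A 0 i₀ * -Real.log ((A *ᵥ u k) i₀ - b i₀) +
      ∑ i ∈ Finset.univ.erase i₀, lev A 0 i * c i) atTop atTop :=
    tendsto_atTop_add_const_right _ _ (hzero.const_mul_atTop (lev_pos hA 0 i₀))
  refine tendsto_atTop_mono' _ ?_ (tendsto_atTop_add_const_left _
    (1 / 2 * (logDet A 0 - |1 - 2 / q| * m)) hsum)
  filter_upwards [eventually_all.mpr hc] with k hk
  refine le_trans ?_ (barrier_ge hA hq (hu k))
  rw [sub_eq_add_neg _ (∑ i, _), ← Finset.sum_neg_distrib,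
    ← Finset.add_sum_erase _ _ (Finset.mem_univ i₀)]
  refine add_le_add le_rfl (add_le_add (by rw [mul_neg]) (Finset.sum_le_sum fun i _ => ?_))
  rw [← mul_neg]
  exact mul_le_mul_of_nonneg_left (hk i) (lev_pos hA 0 i).le

theorem isBarrier_barrier (hA : NonDegenerate A) (hq : 0 < q) :
    IsBarrier (interiorSet A b) (barrier q A b) where
  isOpen := isOpen_interiorSet A b
  convexOn := convexOn_of_iteratedFDeriv_two_nonneg (convex_interiorSet A b)
    (fun x hx => (contDiffAt_barrier hA hq hx).of_le (by norm_num)) fun x hx h => by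
      have e : (![h, h] : Fin 2 → Fin n → ℝ) = fun _ => h := by
        funext i; fin_cases i <;> rfl
      rw [← e]
      exact second_barrier_nonneg hA hq hx h
  contDiffOn := fun x hx => (contDiffAt_barrier hA hq hx).contDiffWithinAt
  blowsUp := blowsUp_barrier hA hq

theorem IsBarrier.const_mul {K : Set (Fin n → ℝ)} {φ : (Fin n → ℝ) → ℝ} (hφ : IsBarrier K φ)
    {c : ℝ} (hc : 0 < c) : IsBarrier K fun x => c * φ x where
  isOpen := hφ.isOpen
  convexOn := hφ.convexOn.smul hc.le
  contDiffOn := contDiffOn_const.mul hφ.contDiffOn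
  blowsUp := fun u hu p hp hup => (hφ.blowsUp u hu p hp hup).const_mul_atTop hc

/-- Scaling a barrier with `|D³φ| ≤ 2 v (D²φ)^(3/2)` and `(Dφ)² ≤ ν D²φ` by `v²`. -/
theorem IsBarrier.isSelfConcordantBarrier {K : Set (Fin n → ℝ)} {φ : (Fin n → ℝ) → ℝ} {v ν : ℝ}
    (hφ : IsBarrier K φ) (hv : 0 < v) (hν : 0 ≤ ν)
    (h2 : ∀ x ∈ K, ∀ h, 0 ≤ iteratedFDeriv ℝ 2 φ x ![h, h])
    (h3 : ∀ x ∈ K, ∀ h, |iteratedFDeriv ℝ 3 φ x ![h, h, h]| ≤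
      2 * v * √(iteratedFDeriv ℝ 2 φ x ![h, h]) ^ 3)
    (h1 : ∀ x ∈ K, ∀ h, fderiv ℝ φ x h ^ 2 ≤ ν * iteratedFDeriv ℝ 2 φ x ![h, h]) :
    IsSelfConcordantBarrier (ν * v ^ 2) K fun x => v ^ 2 * φ x := by
  have hcd : ∀ x ∈ K, ContDiffAt ℝ 3 φ x := fun x hx =>
    (hφ.contDiffOn x hx).contDiffAt (hφ.isOpen.mem_nhds hx)
  have hsmul : ∀ k : ℕ, (k : WithTop ℕ∞) ≤ 3 → ∀ x ∈ K, ∀ w : Fin k → Fin n → ℝ,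
      iteratedFDeriv ℝ k (fun x => v ^ 2 * φ x) x w = v ^ 2 * iteratedFDeriv ℝ k φ x w := by
    intro k hk x hx w
    have := iteratedFDeriv_const_smul_apply (a := v ^ 2) ((hcd x hx).of_le hk)
    change iteratedFDeriv ℝ k (v ^ 2 • φ) x w = _
    rw [this]
    rfl
  refine ⟨hφ.const_mul (by positivity), fun x hx h => ?_, fun x hx h => ?_⟩
  · rw [hsmul 3 (by norm_num) x hx, hsmul 2 (by norm_num) x hx, abs_mul, abs_mul,
      abs_of_nonneg (h2 x hx h), abs_of_pos (by positivity : 0 < v ^ 2)]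
    set H := iteratedFDeriv ℝ 2 φ x ![h, h] with hH
    -- Scaling by v² multiplies the third derivative by v² but the 3/2 power of the second by v³;
    -- the extra v absorbs the constant.
    have e : (v ^ 2 * H) ^ (3 / 2 : ℝ) = v ^ 3 * √H ^ 3 := by
      rw [rpow_three_halves (mul_nonneg (sq_nonneg v) (h2 x hx h)),
        Real.sqrt_mul (sq_nonneg v), Real.sqrt_sq hv.le, mul_pow]
    rw [e]
    calc v ^ 2 * |iteratedFDeriv ℝ 3 φ x ![h, h, h]| ≤ v ^ 2 * (2 * v * √H ^ 3) :=
          mul_le_mul_of_nonneg_left (h3 x hx h) (sq_nonneg v)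
      _ = _ := by ring
  · rw [hsmul 2 (by norm_num) x hx, abs_mul, abs_of_nonneg (h2 x hx h),
      abs_of_pos (by positivity : 0 < v ^ 2), ← Real.sqrt_eq_rpow]
    have hfd : fderiv ℝ (fun x => v ^ 2 * φ x) x h = v ^ 2 * fderiv ℝ φ x h := by
      rw [fderiv_const_mul ((hcd x hx).differentiableAt (by norm_num))]
      rfl
    rw [hfd, abs_mul, abs_of_pos (by positivity : 0 < v ^ 2), Real.sqrt_mul hν,
      Real.sqrt_mul (sq_nonneg v), Real.sqrt_sq hv.le]
    have h4 : |fderiv ℝ φ x h| ≤ √ν * √(iteratedFDeriv ℝ 2 φ x ![h, h]) := by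
      rw [← Real.sqrt_mul hν]
      exact Real.abs_le_sqrt (h1 x hx h)
    calc v ^ 2 * |fderiv ℝ φ x h| ≤ v ^ 2 * (√ν * √(iteratedFDeriv ℝ 2 φ x ![h, h])) :=
          mul_le_mul_of_nonneg_left h4 (sq_nonneg v)
      _ = _ := by ring

end

end LewisBarrier

end

theorem mainTheorem4 {m n : ℕ} (A : Matrix (Fin m) (Fin n) ℝ) (b : Fin m → ℝ)
    (hA : LewisBarrier.NonDegenerate A) (hΩ : (LewisBarrier.interiorSet A b).Nonempty)
    (q : ℝ) (hq : 0 < q) :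
    -- the maximum (`q ≥ 2`) or minimum (`q ≤ 2`) defining the barrier is attained
    (∀ x ∈ LewisBarrier.interiorSet A b,
      (2 ≤ q → IsGreatest (LewisBarrier.barrierValues q A b x) (LewisBarrier.barrier q A b x)) ∧
      (q ≤ 2 → IsLeast (LewisBarrier.barrierValues q A b x) (LewisBarrier.barrier q A b x))) ∧
    LewisBarrier.IsBarrier (LewisBarrier.interiorSet A b) (LewisBarrier.barrier q A b) ∧
    (∀ x ∈ LewisBarrier.interiorSet A b,
      (LewisBarrier.hess (LewisBarrier.barrier q A b) x).PosDef ∧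
      LewisBarrier.grad (LewisBarrier.barrier q A b) x ⬝ᵥ
        ((LewisBarrier.hess (LewisBarrier.barrier q A b) x)⁻¹ *ᵥ
          LewisBarrier.grad (LewisBarrier.barrier q A b) x) ≤ n) ∧
    (∀ x ∈ LewisBarrier.interiorSet A b, ∀ h : Fin n → ℝ,
      |iteratedFDeriv ℝ 3 (LewisBarrier.barrier q A b) x ![h, h, h]| ≤
        2 * LewisBarrier.concordanceConst q m *
          √(h ⬝ᵥ (LewisBarrier.hess (LewisBarrier.barrier q A b) x *ᵥ h)) ^ 3) ∧
    LewisBarrier.IsSelfConcordantBarrier (n * LewisBarrier.concordanceConst q m ^ 2)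
      (LewisBarrier.interiorSet A b)
      (fun x => LewisBarrier.concordanceConst q m ^ 2 * LewisBarrier.barrier q A b x) := by
  refine ⟨fun x hx => ?_, LewisBarrier.isBarrier_barrier hA hq, fun x hx =>
    ⟨LewisBarrier.hess_barrier_posDef hA hq hx, LewisBarrier.grad_hess_inv_grad_le hA hq hx⟩,
    fun x hx h => ?_, ?_⟩
  · obtain ⟨l, hl⟩ := LewisBarrier.exists_isLewis hA hq b x
    rw [hl.barrier_eq hA hx hq]
    exact ⟨fun h => hl.isGreatest hA hx h, fun h => hl.isLeast hA hx hq h⟩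
  · rw [← LewisBarrier.iteratedFDeriv_two_eq_dotProduct]
    exact LewisBarrier.abs_third_barrier_le hA hq hx h
  · exact (LewisBarrier.isBarrier_barrier hA hq).isSelfConcordantBarrier
      (LewisBarrier.concordanceConst_pos hq) (Nat.cast_nonneg n)
      (fun x hx h => LewisBarrier.second_barrier_nonneg hA hq hx h)
      (fun x hx h => LewisBarrier.abs_third_barrier_le hA hq hx h)
      (fun x hx h => LewisBarrier.first_barrier_sq_le hA hq hx h)
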